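/- **Setting (current status model).** Let $X_1,X_2,\dots$ be i.i.d. with distribution function $F_0$ on $[0,\infty)$ and, independently, let $T_1,T_2,\dots$ be i.i.d. with distribution function $G$ on $[0,\infty)$. Put $\Delta_i=1_{\{X_i\le T_i\}}$. Assume: (F.1) $F_0$ has support $[0,M_0]$, is strictly increasing on $[0,M_0]$, and has a Lebesgue density $f_0$ that is bounded below by a positive constant on $[0,M_0]$. (G.1) $G$ has support $[0,\infty)$, is strictly increasing on $[0,M_0]$, and has a Lebesgue density $g$ on $[0,\infty)$ that is bounded below by a positive constant on $[0,M_0]$ and is differentiable (one-sidedly at $0$) with bounded derivative at the points of $[0,M_0]$. (K.1) $k$ is a symmetric probability density with support $[-1,1]$ that is twice continuously differentiable on $\mathbb R$. Let $h=h_n=cn^{-\alpha}$ with $c>0$ and $\alpha\in(0,1/3)$. For $\beta\in[0,1]$ let $\nu_{i,\beta}=\int_{-1}^{\beta}u^ik(u)\,du$ and $$k^\beta(u)=\frac{\nu_{2,\beta}-\nu_{1,\beta}u}{\nu_{0,\beta}\nu_{2,\beta}-\nu_{1,\beta}^2}\,k(u)\,1_{(-1,\beta)}(u).$$ For $i\in\{0,1\}$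 and $t\ge 0$ let $$\hat g_{n,i}(t)=\frac1{n}\sum_{j\le n:\ \Delta_j=i}\frac1h\,\kappa_t\Big(\frac{t-T_j}{h}\Big),\qquad \kappa_t=\begin{cases}k^{t/h},&0\le t\le h,\\ k,&t>h,\end{cases}$$ $\hat g_n=\hat g_{n,0}+\hat g_{n,1}$, $\hat G_{n,1}(t)=\int_0^t\hat g_{n,1}(u)\,du$, $\hat G_n(t)=\int_0^t\hat g_n(u)\,du$ and $\tau=\sup\{t\ge0:\hat g_n(t)>0\}$. The naive estimator is $\hat F_n^{\rm naive}(t)=\hat g_{n,1}(t)/\hat g_n(t)$, defined where $\hat g_n(t)\neq0$. The maximum smoothed likelihood estimator (MSLE) $\hat F_n^{\rm MS}(t)$ is the right-continuous slope of the lower convex hull of the curve $\{(\hat G_n(s),\hat G_{n,1}(s)):0\le s\le\tau\}$ at the point with $x$-coordinate $\hat G_n(t)$ (right derivative; left derivative at the right end of the hull). **Corollary 3.4.** Under these assumptions, for all $0<m<M<M_0$, $$P\big(\hat F_n^{\rm naive}(t)\text{ is well defined and } \hat F_n^{\rm naive}(t)=\hat F_n^{\rm MS}(t)\text{ for all }t\in[m,M]\big)\longrightarrow1\qquad(n\to\infty).$$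 Moreover, for every $t>0$ (if $t>M_0$, provided that $\hat F_n^{\rm naive}(t)$ is well defined with probability tending to one, i.e. $P(\hat g_n(t)=0)\to0$), $\hat F_n^{\rm MS}(t)$ and $\hat F_n^{\rm naive}(t)$ have the same asymptotic distribution: for all real sequences $(a_n)$, $(b_n)$ and every probability measure $L$ on $\mathbb R$, $a_n(\hat F_n^{\rm MS}(t)-b_n)$ converges in distribution to $L$ if and only if $a_n(\hat F_n^{\rm naive}(t)-b_n)$ does. -/

import Mathlib

open MeasureTheory ProbabilityTheory Filter Topology Set

noncomputable section

namespace CurrentStatus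

/-- Current status model: `X 0, X 1, …` is an i.i.d. sequence with law `PX`, independent of the
i.i.d. sequence `T 0, T 1, …` with law `PT`. -/
structure Model {Ω : Type*} [MeasurableSpace Ω] (P : Measure Ω) (X T : ℕ → Ω → ℝ)
    (PX PT : Measure ℝ) : Prop where
  measurable_X : ∀ i, Measurable (X i)
  measurable_T : ∀ i, Measurable (T i)
  law_X : ∀ i, P.map (X i) = PX
  law_T : ∀ i, P.map (T i) = PT
  indep_X : iIndepFun X P
  indep_T : iIndepFun T P
  indep_X_T : IndepFun (fun ω i => X i ω) (fun ω i => T i ω) P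

/-- `f` is a Lebesgue density of `Q`. -/
structure IsDensity (Q : Measure ℝ) (f : ℝ → ℝ) : Prop where
  measurable : Measurable f
  nonneg : ∀ x, 0 ≤ f x
  eq_withDensity : Q = volume.withDensity (fun x => ENNReal.ofReal (f x))

/-- Condition (F.1): the law with distribution function `F₀` has support `[0, M₀]`, `F₀` is strictly
increasing there, and its density `f₀` stays away from zero there. -/
structure ConditionF1 (PX : Measure ℝ) (f₀ : ℝ → ℝ) (M₀ : ℝ) : Prop where
  density : IsDensity PX f₀
  support_eq : PX.support = Icc 0 M₀
  strictMonoOn : StrictMonoOn (cdf PX) (Icc 0 M₀)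
  away_from_zero : ∃ ε > 0, ∀ x ∈ Icc 0 M₀, ε ≤ f₀ x

/-- Condition (G.1): the law with distribution function `G` has support `[0, ∞)`; on `[0, M₀]`, `G` is
strictly increasing, its density `g` stays away from zero, and `g` (as a function on `[0, ∞)`) is
differentiable with bounded derivative. -/
structure ConditionG1 (PT : Measure ℝ) (g : ℝ → ℝ) (M₀ : ℝ) : Prop where
  density : IsDensity PT g
  support_eq : PT.support = Ici 0
  strictMonoOn : StrictMonoOn (cdf PT) (Icc 0 M₀)
  away_from_zero : ∃ ε > 0, ∀ x ∈ Icc 0 M₀, ε ≤ g x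
  differentiable : ∀ x ∈ Icc 0 M₀, DifferentiableWithinAt ℝ g (Ici 0) x
  bounded_deriv : ∃ B, ∀ x ∈ Icc 0 M₀, |derivWithin g (Ici 0) x| ≤ B

/-- Condition (K.1): `k` is a symmetric, twice continuously differentiable probability density with
support `[-1, 1]`. -/
structure ConditionK1 (k : ℝ → ℝ) : Prop where
  nonneg : ∀ u, 0 ≤ k u
  integral_eq_one : ∫ u, k u = 1
  support_eq : tsupport k = Icc (-1) 1
  symmetric : ∀ u, k (-u) = k u
  contDiff : ContDiff ℝ 2 k

/-- `ν_{i,β}(k) = ∫_{-1}^β u^i k(u) du`. -/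
def nu (k : ℝ → ℝ) (i : ℕ) (β : ℝ) : ℝ := ∫ u in (-1)..β, u ^ i * k u

/-- The boundary kernel `k^β`. -/
def boundaryKernel (k : ℝ → ℝ) (β u : ℝ) : ℝ :=
  (Ioo (-1) β).indicator
    (fun u => (nu k 2 β - nu k 1 β * u) / (nu k 0 β * nu k 2 β - nu k 1 β ^ 2) * k u) u

/-- The kernel used at the point `t`, boundary corrected for `t ≤ h`. -/
def kernelAt (k : ℝ → ℝ) (h t : ℝ) : ℝ → ℝ :=
  if t ≤ h then boundaryKernel k (t / h) else k

/-- The indicator `Δ = 1_{X ≤ T}`. -/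
def delta (x y : ℝ) : Fin 2 := if x ≤ y then 1 else 0

/-! In the estimators below, `h` is the bandwidth, `n` the sample size, `x j` and `y j` (for `j < n`)
are the values of the event times `X` and of the inspection times `T`. The event times enter only
through the indicators `delta (x j) (y j)`. -/

/-- `ĝ_{n,i}(t)`, the integral of `(1/h) κ((t - u)/h)` with respect to the empirical subdistribution
of the inspection times with indicator `i`, where `κ = kernelAt k h t`. -/
def gHatSub (k : ℝ → ℝ) (h : ℝ) (n : ℕ) (x y : ℕ → ℝ) (i : Fin 2) (t : ℝ) : ℝ :=
  (1 / (n : ℝ)) * ∑ j ∈ Finset.range n,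
    if delta (x j) (y j) = i then (1 / h) * kernelAt k h t ((t - y j) / h) else 0

/-- `ĝ_n = ĝ_{n,0} + ĝ_{n,1}`. -/
def gHat (k : ℝ → ℝ) (h : ℝ) (n : ℕ) (x y : ℕ → ℝ) (t : ℝ) : ℝ :=
  gHatSub k h n x y 0 t + gHatSub k h n x y 1 t

/-- `Ĝ_{n,i}(t) = ∫_0^t ĝ_{n,i}(u) du`. -/
def GHatSub (k : ℝ → ℝ) (h : ℝ) (n : ℕ) (x y : ℕ → ℝ) (i : Fin 2) (t : ℝ) : ℝ :=
  ∫ u in (0)..t, gHatSub k h n x y i u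

/-- `Ĝ_n(t) = ∫_0^t ĝ_n(u) du`. -/
def GHat (k : ℝ → ℝ) (h : ℝ) (n : ℕ) (x y : ℕ → ℝ) (t : ℝ) : ℝ :=
  ∫ u in (0)..t, gHat k h n x y u

/-- The naive estimator `ĝ_{n,1} / ĝ_n`. -/
def naive (k : ℝ → ℝ) (h : ℝ) (n : ℕ) (x y : ℕ → ℝ) (t : ℝ) : ℝ :=
  gHatSub k h n x y 1 t / gHat k h n x y t

/-- `τ = sup {t ≥ 0 : ĝ_n(t) > 0}`. -/
def tau (k : ℝ → ℝ) (h : ℝ) (n : ℕ) (x y : ℕ → ℝ) : ℝ :=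
  sSup {t | 0 ≤ t ∧ 0 < gHat k h n x y t}

/-- The continuous cumulative sum diagram `{(Ĝ_n(t), Ĝ_{n,1}(t)) : 0 ≤ t ≤ τ}`. -/
def ccsd (k : ℝ → ℝ) (h : ℝ) (n : ℕ) (x y : ℕ → ℝ) : Set (ℝ × ℝ) :=
  (fun t => (GHat k h n x y t, GHatSub k h n x y 1 t)) '' Icc 0 (tau k h n x y)

/-- The lower boundary of the convex hull of a planar set, as a function of the abscissa. -/
def lowerHull (S : Set (ℝ × ℝ)) (v : ℝ) : ℝ := sInf {w | (v, w) ∈ convexHull ℝ S}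

open Classical in
/-- The slope of the lower convex hull of `S` at abscissa `v`: the right derivative, or, at the right
end of the hull (where there is no right derivative), the left derivative. -/
def hullSlope (S : Set (ℝ × ℝ)) (v : ℝ) : ℝ :=
  if ∃ p ∈ S, v < p.1 then derivWithin (lowerHull S) (Ioi v) v
  else derivWithin (lowerHull S) (Iio v) v

/-- The maximum smoothed likelihood estimator: the right-continuous slope of the lower convex hull of
the continuous cumulative sum diagram at the point with abscissa `Ĝ_n(t)`. -/
def msle (k : ℝ → ℝ) (h : ℝ) (n : ℕ) (x y : ℕ → ℝ) (t : ℝ) : ℝ :=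
  hullSlope (ccsd k h n x y) (GHat k h n x y t)

/-- The bandwidth `c n^{-α}`. -/
def bandwidth (c α : ℝ) (n : ℕ) : ℝ := c * (n : ℝ) ^ (-α)

/-- `ĝ_n(t)` computed from the random sample, with bandwidth `c n^{-α}`. -/
def gHatRV {Ω : Type*} (k : ℝ → ℝ) (c α : ℝ) (X T : ℕ → Ω → ℝ) (n : ℕ) (t : ℝ) (ω : Ω) : ℝ :=
  gHat k (bandwidth c α n) n (fun j => X j ω) (fun j => T j ω) t

/-- The naive estimator computed from the random sample, with bandwidth `c n^{-α}`. -/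
def naiveRV {Ω : Type*} (k : ℝ → ℝ) (c α : ℝ) (X T : ℕ → Ω → ℝ) (n : ℕ) (t : ℝ) (ω : Ω) : ℝ :=
  naive k (bandwidth c α n) n (fun j => X j ω) (fun j => T j ω) t

/-- The MSLE computed from the random sample, with bandwidth `c n^{-α}`. -/
def msleRV {Ω : Type*} (k : ℝ → ℝ) (c α : ℝ) (X T : ℕ → Ω → ℝ) (n : ℕ) (t : ℝ) (ω : Ω) : ℝ :=
  msle k (bandwidth c α n) n (fun j => X j ω) (fun j => T j ω) t

/-- `Y n` converges in distribution to the law `L`: the distribution functions converge at every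
continuity point of the distribution function of `L`. -/
def ConvergesInLaw {Ω : Type*} [MeasurableSpace Ω] (P : Measure Ω) (Y : ℕ → Ω → ℝ)
    (L : Measure ℝ) : Prop :=
  ∀ z, ContinuousAt (cdf L) z →
    Tendsto (fun n => P.real {ω | Y n ω ≤ z}) atTop (𝓝 (cdf L z))

end CurrentStatus

end

/-!
The naive estimator is `a / b` with `a = ĝ_{n,1}` and `b = ĝ_n`, and the cumulative sum diagram is
the curve `(∫ b, ∫ a)`. If the line through the point with parameter `t` and slope `r = a t / b t`
supports the diagram from below, that is, if `∫_t^s (a - r b) ≥ 0` for all `s ≥ 0`, then `r` is the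
slope of the lower convex hull at that point (`hullSlope_eq_of_support`,
`ConditionK1.msle_eq_naive`). So it suffices that this inequality holds, with probability tending
to one, simultaneously for all `t ∈ [m, M₀]` and all `t > M₀ + h` with `b t ≠ 0`
(`whp_msle_eq_naive`); estimators that agree with probability tending to one have the same limits
in law.

The supporting inequality follows from the monotonicity of `a / b`. The expectations of `a` and `b`
are kernel smoothers of `F₀ g` and `g`. Up to a factor bounded away from zero, the numerator of the
derivative of their ratio is a kernel smoother of the law of `X`, plus an error which vanishes as
`h → 0` since `g` is Lipschitz and `F₀` is uniformly continuous
(`ConditionK1.numerator_lower_bound`, `exists_population_bounds`). It is therefore bounded away from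
zero on `[h, M₀ + h / 2]` and asymptotically nonnegative on `[M₀ + h / 2, M₀ + h]`. The density `f₀`
may be unbounded, so that the derivatives of the expectations are only bounded by a multiple of
`1 / h`.

The estimators and their derivatives are uniformly close to their expectations, with error `o(h)`
for the estimators and `o(1)` for the derivatives: a Bernstein-type bound with effective sample
size `n h³ = c³ n^{1 - 3α}` is combined with a grid of polynomial size
(`kernelAverage_uniform_concentration`, `whp_kernelAverage`). This is where `α < 1/3` is used.

Hence `a / b` increases at a fixed rate on `(h, M₀ + h / 2]`, and the small possible decrease on the
last half bandwidth before `M₀ + h` is compensated by the increase on the half bandwidth after `M₀`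
(`le_of_deriv_bounds`). Beyond `M₀ + h` one has `a = b`. On the boundary region `[0, h]` the
boundary kernel may be negative, but `a` and `b` are bounded in probability there, so that their
integrals over it are negligible compared with the gain from the strict increase of `a / b` on
`(h, M₀]` (`integral_sub_mul_nonneg`).
-/

noncomputable section

namespace CurrentStatus

/-! ### The slope of the lower convex hull -/

/-- A point of `S` lying on a line that supports `S` from below lies on the lower hull, and the hull
stays above that line. -/
lemma lowerHull_eq_of_support {S : Set (ℝ × ℝ)} {p : ℝ × ℝ} {r : ℝ} (hp : p ∈ S)
    (hS : ∀ q ∈ S, p.2 + r * (q.1 - p.1) ≤ q.2) :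
    lowerHull S p.1 = p.2 ∧
      ∀ q ∈ S, p.2 + r * (q.1 - p.1) ≤ lowerHull S q.1 ∧ lowerHull S q.1 ≤ q.2 := by
  have hconv : convexHull ℝ S ⊆ {q | p.2 + r * (q.1 - p.1) ≤ q.2} := by
    refine convexHull_min hS ?_
    intro q hq q' hq' a b ha hb hab
    simp only [mem_ofPred_eq, Prod.fst_add, Prod.snd_add, Prod.smul_fst, Prod.smul_snd,
      smul_eq_mul] at *
    obtain rfl : b = 1 - a := by linarith
    linarith [mul_le_mul_of_nonneg_left hq ha, mul_le_mul_of_nonneg_left hq' hb]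
  have key : ∀ q ∈ S, p.2 + r * (q.1 - p.1) ≤ lowerHull S q.1 ∧ lowerHull S q.1 ≤ q.2 := by
    intro q hq
    have hmem : q.2 ∈ {w | (q.1, w) ∈ convexHull ℝ S} := subset_convexHull ℝ S hq
    have hlb : ∀ w ∈ {w | (q.1, w) ∈ convexHull ℝ S}, p.2 + r * (q.1 - p.1) ≤ w :=
      fun w hw => hconv hw
    exact ⟨le_csInf ⟨_, hmem⟩ hlb, csInf_le ⟨_, hlb⟩ hmem⟩
  refine ⟨le_antisymm (key p hp).2 ?_, key⟩
  simpa using (key p hp).1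

/-- Let a curve `(B, A)` be differentiable at a parameter `t < τ` with `B' > 0`. If the tangent
at `t` supports the curve from below, then its slope is the slope of the lower convex hull at
`B t`. -/
lemma hullSlope_eq_of_support {A B : ℝ → ℝ} {τ t a b : ℝ} (ht0 : 0 ≤ t) (htτ : t < τ)
    (hA : HasDerivAt A a t) (hB : HasDerivAt B b t) (hBc : ContinuousOn B (Icc 0 τ)) (hb : 0 < b)
    (hsup : ∀ s ∈ Icc 0 τ, a / b * (B s - B t) ≤ A s - A t) :
    hullSlope ((fun s => (B s, A s)) '' Icc 0 τ) (B t) = a / b := by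
  set S : Set (ℝ × ℝ) := (fun s => (B s, A s)) '' Icc 0 τ with hSdef
  set r := a / b with hr
  have htmem : (B t, A t) ∈ S := ⟨t, ⟨ht0, htτ.le⟩, rfl⟩
  have hS : ∀ q ∈ S, A t + r * (q.1 - B t) ≤ q.2 := by
    rintro _ ⟨s, hs, rfl⟩
    have := hsup s hs
    simp only
    linarith
  obtain ⟨hval, hbd⟩ := lowerHull_eq_of_support htmem hS
  simp only at hval hbd
  -- to the right of `t`, `B` increases and `A - r B` is negligible compared with the increase
  have hloc : ∀ ε > 0, ∃ e > 0, ∀ s ∈ Ioo t (t + e), s ≤ τ ∧ B t < B s ∧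
      A s - A t - r * (B s - B t) ≤ ε * (B s - B t) := by
    intro ε hε
    have hD : HasDerivAt (fun s => A s - r * B s) 0 t := by
      have := hA.sub (hB.const_mul r)
      rwa [hr, div_mul_cancel₀ _ hb.ne', sub_self] at this
    have h1 := (hasDerivAt_iff_isLittleO.1 hD).def (show 0 < ε * (b / 2) by positivity)
    have h2 := (hasDerivAt_iff_isLittleO.1 hB).def (show 0 < b / 2 by positivity)
    obtain ⟨e, he, hball⟩ := Metric.eventually_nhds_iff.1 (h1.and h2)
    refine ⟨min e (τ - t), lt_min he (sub_pos.2 htτ), fun s hs => ?_⟩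
    have hs1 : t < s := hs.1
    have hs2 : s < t + e := hs.2.trans_le (by gcongr; exact min_le_left _ _)
    have hs3 : s < τ := by
      have := hs.2.trans_le (add_le_add_right (min_le_right e (τ - t)) t)
      linarith
    obtain ⟨k1, k2⟩ := hball (y := s) (by rw [Real.dist_eq, abs_of_pos] <;> linarith)
    simp only [smul_eq_mul, mul_zero, sub_zero, Real.norm_eq_abs] at k1 k2
    rw [abs_of_pos (sub_pos.2 hs1)] at k1 k2
    have k1' := (abs_le.1 k1).2
    have k2' := (abs_le.1 k2).1
    have hpos : 0 < b / 2 * (s - t) := mul_pos (by positivity) (sub_pos.2 hs1)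
    have hB' : b / 2 * (s - t) ≤ B s - B t := by linarith
    refine ⟨hs3.le, by linarith, ?_⟩
    have := mul_le_mul_of_nonneg_left hB' hε.le
    linarith
  have hder : HasDerivWithinAt (lowerHull S) r (Ioi (B t)) (B t) := by
    rw [hasDerivWithinAt_iff_isLittleO, Asymptotics.isLittleO_iff]
    intro ε hε
    obtain ⟨e, he, hloc⟩ := hloc ε hε
    set s₁ := t + e / 2 with hs₁
    have hs₁m : s₁ ∈ Ioo t (t + e) := ⟨by linarith, by linarith⟩
    obtain ⟨hs₁τ, hs₁B, -⟩ := hloc s₁ hs₁m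
    have hcont : ContinuousOn B (Icc t s₁) := hBc.mono (Icc_subset_Icc ht0 hs₁τ)
    filter_upwards [Ioo_mem_nhdsGT hs₁B] with v hv
    obtain ⟨s, hs, rfl⟩ := intermediate_value_Ioo hs₁m.1.le hcont hv
    obtain ⟨k1, k2, k3⟩ := hloc s ⟨hs.1, hs.2.trans hs₁m.2⟩
    obtain ⟨l1, l2⟩ := hbd (B s, A s) ⟨s, ⟨ht0.trans hs.1.le, k1⟩, rfl⟩
    simp only at l1 l2
    rw [hval, Real.norm_eq_abs, Real.norm_eq_abs, abs_of_pos (sub_pos.2 k2), smul_eq_mul, abs_le]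
    have : 0 ≤ ε * (B s - B t) := mul_nonneg hε.le (sub_pos.2 k2).le
    constructor <;> linarith
  obtain ⟨e, he, hloc1⟩ := hloc 1 one_pos
  obtain ⟨k1, k2, -⟩ := hloc1 (t + e / 2) ⟨by linarith, by linarith⟩
  have hex : ∃ p ∈ S, B t < p.1 := ⟨_, ⟨t + e / 2, ⟨by linarith, k1⟩, rfl⟩, k2⟩
  rw [hullSlope, if_pos hex]
  exact hder.derivWithin (uniqueDiffWithinAt_Ioi _)

/-! ### Independence of the pairs and a Bernstein-type inequality -/

/-- The pairs of an i.i.d. current status sample are independent. -/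
lemma Model.iIndepFun_prod {Ω : Type*} [MeasurableSpace Ω] {P : Measure Ω} {X T : ℕ → Ω → ℝ}
    {PX PT : Measure ℝ} (h : Model P X T PX PT) : iIndepFun (fun i ω => (X i ω, T i ω)) P := by
  rw [iIndepFun_iff_iIndep]
  refine iIndepSets.iIndep (fun i => ((h.measurable_X i).prodMk (h.measurable_T i)).comap_le)
    (fun i => preimage (fun ω => (X i ω, T i ω)) ''
      image2 (fun s t : Set ℝ => s ×ˢ t) {s | MeasurableSet s} {t | MeasurableSet t})
    (fun i => ?_) (fun i => ?_) ?_
  · have := (isPiSystem_prod (α := ℝ) (β := ℝ)).comap (fun ω => (X i ω, T i ω))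
    exact this
  · rw [← MeasurableSpace.comap_generateFrom, generateFrom_prod]
  · rw [iIndepSets_iff]
    intro S f hf
    choose! s hs hsf using hf
    simp only [mem_image2, mem_ofPred_eq] at hs
    choose! u hu v hv huv using hs
    have hset : ∀ i ∈ S, f i = X i ⁻¹' u i ∩ T i ⁻¹' v i := fun i hi => by
      rw [← hsf i hi, ← huv i hi]; rfl
    have hXm : ∀ i ∈ S, P (X i ⁻¹' u i ∩ T i ⁻¹' v i) = P (X i ⁻¹' u i) * P (T i ⁻¹' v i) := by
      intro i hi
      have hi' : IndepFun (X i) (T i) P :=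
        h.indep_X_T.comp (measurable_pi_apply i) (measurable_pi_apply i)
      exact indepFun_iff_measure_inter_preimage_eq_mul.1 hi' _ _ (hu i hi) (hv i hi)
    have hall := indepFun_iff_measure_inter_preimage_eq_mul.1 h.indep_X_T
      (⋂ i ∈ S, (fun x : ℕ → ℝ => x i) ⁻¹' u i) (⋂ i ∈ S, (fun x : ℕ → ℝ => x i) ⁻¹' v i)
      (S.measurableSet_biInter fun i hi => measurable_pi_apply i (hu i hi))
      (S.measurableSet_biInter fun i hi => measurable_pi_apply i (hv i hi))
    simp only [preimage_iInter, ← preimage_comp, Function.comp_def] at hall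
    have e1 := iIndepFun_iff_measure_inter_preimage_eq_mul.1 h.indep_X S hu
    have e2 := iIndepFun_iff_measure_inter_preimage_eq_mul.1 h.indep_T S hv
    calc P (⋂ i ∈ S, f i) = P ((⋂ i ∈ S, X i ⁻¹' u i) ∩ ⋂ i ∈ S, T i ⁻¹' v i) := by
          congr 1
          ext ω
          simp only [mem_iInter, mem_inter_iff]
          constructor
          · intro hω
            exact ⟨fun i hi => ((hset i hi) ▸ hω i hi).1, fun i hi => ((hset i hi) ▸ hω i hi).2⟩
          · intro hω i hi
            rw [hset i hi]
            exact ⟨hω.1 i hi, hω.2 i hi⟩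
      _ = P (⋂ i ∈ S, X i ⁻¹' u i) * P (⋂ i ∈ S, T i ⁻¹' v i) := hall
      _ = ∏ i ∈ S, P (f i) := by
          rw [e1, e2, ← Finset.prod_mul_distrib]
          refine Finset.prod_congr rfl fun i hi => ?_
          rw [hset i hi, hXm i hi]

/-- The moment generating function of a centred bounded variable is at most `exp (l² V)` as long as
`l` times the bound does not exceed one, where `V` bounds the second moment. -/
lemma mgf_le_of_bounded {Ω : Type*} [MeasurableSpace Ω] {P : Measure Ω} [IsProbabilityMeasure P]
    {Y : Ω → ℝ} (hY : Measurable Y) {A V l : ℝ} (hA : ∀ ω, |Y ω| ≤ A) (hmean : ∫ ω, Y ω ∂P = 0)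
    (hV : ∫ ω, Y ω ^ 2 ∂P ≤ V) (hl : 0 ≤ l) (hlA : l * A ≤ 1) :
    Integrable (fun ω => Real.exp (l * Y ω)) P ∧ mgf Y P l ≤ Real.exp (l ^ 2 * V) := by
  have hb : ∀ ω, |l * Y ω| ≤ 1 := fun ω => by
    rw [abs_mul, abs_of_nonneg hl]
    exact (mul_le_mul_of_nonneg_left (hA ω) hl).trans hlA
  have hi : Integrable (fun ω => Real.exp (l * Y ω)) P := by
    refine Integrable.of_bound (C := Real.exp 1) (by fun_prop) (ae_of_all _ fun ω => ?_)
    rw [Real.norm_eq_abs, abs_of_pos (Real.exp_pos _)]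
    exact Real.exp_le_exp.2 (le_of_abs_le (hb ω))
  have hYi : Integrable Y P :=
    Integrable.of_bound (C := A) hY.aestronglyMeasurable (ae_of_all _ hA)
  have hY2 : Integrable (fun ω => Y ω ^ 2) P := by
    refine Integrable.of_bound (C := A ^ 2) (by fun_prop) (ae_of_all _ fun ω => ?_)
    rw [Real.norm_eq_abs, abs_pow]
    exact pow_le_pow_left₀ (abs_nonneg _) (hA ω) 2
  refine ⟨hi, ?_⟩
  calc mgf Y P l ≤ ∫ ω, (1 + l * Y ω + l ^ 2 * Y ω ^ 2) ∂P := by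
        refine integral_mono hi (((integrable_const _).add (hYi.const_mul l)).add
          (hY2.const_mul _)) fun ω => ?_
        have := (abs_le.1 (Real.abs_exp_sub_one_sub_id_le (hb ω))).2
        simp only
        nlinarith
    _ = 1 + l ^ 2 * ∫ ω, Y ω ^ 2 ∂P := by
        have e1 := integral_add (μ := P) ((integrable_const (1 : ℝ)).add (hYi.const_mul l))
          (hY2.const_mul (l ^ 2))
        have e2 := integral_add (μ := P) (integrable_const (1 : ℝ)) (hYi.const_mul l)
        simp only [Pi.add_apply] at e1
        rw [e1, e2, integral_const_mul, integral_const_mul, hmean]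
        simp
    _ ≤ 1 + l ^ 2 * V := by gcongr
    _ ≤ Real.exp (l ^ 2 * V) := by linarith [Real.add_one_le_exp (l ^ 2 * V)]

/-- One-sided Bernstein-type inequality with a free parameter `l`. -/
lemma bernstein_one_sided {Ω : Type*} [MeasurableSpace Ω] {P : Measure Ω} [IsProbabilityMeasure P]
    {Y : ℕ → Ω → ℝ} (hY : ∀ i, Measurable (Y i)) (hind : iIndepFun Y P) {A V l : ℝ}
    (hA : ∀ i ω, |Y i ω| ≤ A) (hmean : ∀ i, ∫ ω, Y i ω ∂P = 0)
    (hV : ∀ i, ∫ ω, Y i ω ^ 2 ∂P ≤ V) (hl : 0 ≤ l) (hlA : l * A ≤ 1) (n : ℕ) (x : ℝ) :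
    P.real {ω | x ≤ ∑ i ∈ Finset.range n, Y i ω} ≤ Real.exp (-l * x + n * (l ^ 2 * V)) := by
  have hm := fun i => mgf_le_of_bounded (hY i) (hA i) (hmean i) (hV i) hl hlA
  have h1 := measure_ge_le_exp_mul_mgf (μ := P) (X := ∑ i ∈ Finset.range n, Y i) x hl
    (hind.integrable_exp_mul_sum hY fun i _ => (hm i).1)
  rw [hind.mgf_sum hY] at h1
  simp only [Finset.sum_apply] at h1
  refine h1.trans ?_
  rw [Real.exp_add]
  gcongr
  calc ∏ i ∈ Finset.range n, mgf (Y i) P l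
      ≤ ∏ _i ∈ Finset.range n, Real.exp (l ^ 2 * V) :=
        Finset.prod_le_prod (fun i _ => mgf_nonneg) fun i _ => (hm i).2
    _ = Real.exp (n * (l ^ 2 * V)) := by
        rw [Finset.prod_const, Finset.card_range, ← Real.exp_nat_mul]

/-- Two-sided Bernstein-type inequality for the mean of independent centred variables bounded by
`A` with second moments at most `V`. -/
lemma bernstein {Ω : Type*} [MeasurableSpace Ω] {P : Measure Ω} [IsProbabilityMeasure P]
    {Y : ℕ → Ω → ℝ} (hY : ∀ i, Measurable (Y i)) (hind : iIndepFun Y P) {A V η : ℝ}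
    (hA : ∀ i ω, |Y i ω| ≤ A) (hmean : ∀ i, ∫ ω, Y i ω ∂P = 0)
    (hV : ∀ i, ∫ ω, Y i ω ^ 2 ∂P ≤ V) (hVpos : 0 < V) (hη : 0 ≤ η) (hηA : η * A ≤ 2 * V) {n : ℕ}
    (hn : 0 < n) :
    P.real {ω | η ≤ |(1 / (n : ℝ)) * ∑ i ∈ Finset.range n, Y i ω|} ≤
      2 * Real.exp (-(n * η ^ 2 / (4 * V))) := by
  have hn' : (0 : ℝ) < n := by exact_mod_cast hn
  have hl : 0 ≤ η / (2 * V) := by positivity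
  have hlA : η / (2 * V) * A ≤ 1 := by
    rw [div_mul_eq_mul_div, div_le_one (by positivity)]
    exact hηA
  -- the choice `l = η / (2 V)` minimizes the exponent
  have hexp : -(η / (2 * V)) * (n * η) + n * ((η / (2 * V)) ^ 2 * V) = -(n * η ^ 2 / (4 * V)) := by
    field_simp
    ring
  have h1 := bernstein_one_sided hY hind hA hmean hV hl hlA n (n * η)
  have h2 := bernstein_one_sided (Y := fun i ω => -Y i ω) (fun i => (hY i).neg)
    (hind.comp (fun _ x => -x) fun _ => measurable_neg) (A := A) (V := V)
    (fun i ω => by simpa using hA i ω) (fun i => by rw [integral_neg, hmean, neg_zero])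
    (fun i => by simpa using hV i) hl hlA n (n * η)
  rw [hexp] at h1 h2
  have hsub : {ω | η ≤ |(1 / (n : ℝ)) * ∑ i ∈ Finset.range n, Y i ω|} ⊆
      {ω | n * η ≤ ∑ i ∈ Finset.range n, Y i ω} ∪ {ω | n * η ≤ ∑ i ∈ Finset.range n, -Y i ω} := by
    intro ω hω
    simp only [mem_ofPred_eq, mem_union, Finset.sum_neg_distrib] at hω ⊢
    rw [abs_mul, abs_of_pos (by positivity), one_div, inv_mul_eq_div, le_div_iff₀ hn',
      mul_comm] at hω
    exact le_abs.1 hω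
  calc _ ≤ _ := measureReal_mono hsub
    _ ≤ _ := measureReal_union_le _ _
    _ ≤ _ := by linarith

/-! ### Uniform concentration of kernel averages -/

/-- The kernel average `n⁻¹ ∑_{j<n} w(x_j, y_j) h⁻² φ((t - y_j) / h)` of a sample. With `φ = k'` it
is the derivative of a kernel density estimator; with `φ = k` it is that estimator divided by
`h`. -/
def kernelAverage (φ : ℝ → ℝ) (w : ℝ × ℝ → ℝ) (h : ℝ) (n : ℕ) (x y : ℕ → ℝ) (t : ℝ) : ℝ :=
  (1 / (n : ℝ)) * ∑ j ∈ Finset.range n, w (x j, y j) * (h⁻¹ ^ 2 * φ ((t - y j) / h))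

/-- The expectation of `kernelAverage` when the pairs have law `PX.prod PT`. -/
def kernelMean (φ : ℝ → ℝ) (w : ℝ × ℝ → ℝ) (PX PT : Measure ℝ) (h t : ℝ) : ℝ :=
  ∫ z, w z * (h⁻¹ ^ 2 * φ ((t - z.2) / h)) ∂(PX.prod PT)

lemma Model.isProbabilityMeasure {Ω : Type*} [MeasurableSpace Ω] {P : Measure Ω}
    [IsProbabilityMeasure P] {X T : ℕ → Ω → ℝ} {PX PT : Measure ℝ} (h : Model P X T PX PT) :
    IsProbabilityMeasure PX ∧ IsProbabilityMeasure PT :=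
  ⟨h.law_X 0 ▸ Measure.isProbabilityMeasure_map (h.measurable_X 0).aemeasurable,
    h.law_T 0 ▸ Measure.isProbabilityMeasure_map (h.measurable_T 0).aemeasurable⟩

lemma Model.map_prod {Ω : Type*} [MeasurableSpace Ω] {P : Measure Ω} [IsProbabilityMeasure P]
    {X T : ℕ → Ω → ℝ} {PX PT : Measure ℝ} (h : Model P X T PX PT) (j : ℕ) :
    P.map (fun ω => (X j ω, T j ω)) = PX.prod PT := by
  have hi' : IndepFun (X j) (T j) P :=
    h.indep_X_T.comp (measurable_pi_apply j) (measurable_pi_apply j)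
  rw [(indepFun_iff_map_prod_eq_prod_map_map (h.measurable_X j).aemeasurable
    (h.measurable_T j).aemeasurable).1 hi', h.law_X, h.law_T]

lemma abs_kernel_term_le {φ : ℝ → ℝ} {w : ℝ × ℝ → ℝ} {K : ℝ} (hK : ∀ u, |φ u| ≤ K)
    (hw : ∀ z, |w z| ≤ 1) (h t : ℝ) (z : ℝ × ℝ) :
    |w z * (h⁻¹ ^ 2 * φ ((t - z.2) / h))| ≤ h⁻¹ ^ 2 * K := by
  rw [abs_mul, abs_mul, abs_of_nonneg (by positivity : 0 ≤ h⁻¹ ^ 2)]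
  calc _ ≤ 1 * (h⁻¹ ^ 2 * K) := mul_le_mul (hw z) (by gcongr; exact hK _) (by positivity) one_pos.le
    _ = _ := one_mul _

lemma measurable_kernel_term {φ : ℝ → ℝ} {w : ℝ × ℝ → ℝ} (hφ : Measurable φ) (hw : Measurable w)
    (h t : ℝ) : Measurable fun z : ℝ × ℝ => w z * (h⁻¹ ^ 2 * φ ((t - z.2) / h)) := by
  fun_prop

lemma mem_Icc_of_div_mem {h t y : ℝ} (hh : 0 < h) (hy : |(t - y) / h| ≤ 1) :
    y ∈ Icc (t - h) (t + h) := by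
  rw [abs_div, abs_of_pos hh, div_le_one hh, abs_le] at hy
  constructor <;> linarith [hy.1, hy.2]

/-- Pointwise concentration: the second moment of a summand is of order `h⁻³`, so that the relevant
sample size is `n h³`. -/
lemma kernelAverage_concentration {Ω : Type*} [MeasurableSpace Ω] {P : Measure Ω}
    [IsProbabilityMeasure P] {X T : ℕ → Ω → ℝ} {PX PT : Measure ℝ} (hM : Model P X T PX PT)
    {φ : ℝ → ℝ} {w : ℝ × ℝ → ℝ} {K C h t η : ℝ} (hφ : Measurable φ) (hwm : Measurable w)
    (hK : ∀ u, |φ u| ≤ K) (hKpos : 0 < K) (hφ0 : ∀ u, 1 < |u| → φ u = 0) (hw : ∀ z, |w z| ≤ 1)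
    (hC : 0 < C) (hh : 0 < h) (hPT : PT.real (Icc (t - h) (t + h)) ≤ C * h) (hη : 0 ≤ η)
    (hηh : η * h ≤ K * C) {n : ℕ} (hn : 0 < n) :
    P.real {ω | η ≤ |kernelAverage φ w h n (fun j => X j ω) (fun j => T j ω) t -
        kernelMean φ w PX PT h t|} ≤ 2 * Real.exp (-(n * h ^ 3 * (η ^ 2 / (4 * (K ^ 2 * C))))) := by
  obtain ⟨hPX, hPT'⟩ := hM.isProbabilityMeasure
  set Z : ℝ × ℝ → ℝ := fun z => w z * (h⁻¹ ^ 2 * φ ((t - z.2) / h)) with hZ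
  set e := kernelMean φ w PX PT h t with he
  have hZm : Measurable Z := measurable_kernel_term hφ hwm h t
  have hZb : ∀ z, |Z z| ≤ h⁻¹ ^ 2 * K := abs_kernel_term_le hK hw h t
  have hpair : ∀ j, Measurable fun ω => (X j ω, T j ω) := fun j =>
    (hM.measurable_X j).prodMk (hM.measurable_T j)
  have heb : |e| ≤ h⁻¹ ^ 2 * K := by
    have := norm_integral_le_of_norm_le_const (μ := PX.prod PT) (f := Z)
      (ae_of_all _ hZb)
    simpa [he, kernelMean, hZ] using this
  have hEZ : ∀ j, ∫ ω, Z (X j ω, T j ω) ∂P = e := fun j => by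
    rw [he, kernelMean, ← hM.map_prod j,
      integral_map (hpair j).aemeasurable hZm.aestronglyMeasurable]
  have hZi : ∀ j, Integrable (fun ω => Z (X j ω, T j ω)) P := fun j =>
    Integrable.of_bound (hZm.comp (hpair j)).aestronglyMeasurable _
      (ae_of_all _ fun ω => hZb _)
  set V : ℝ := K ^ 2 * C / h ^ 3 with hV
  have hVpos : 0 < V := by positivity
  have hsecond : ∀ j, ∫ ω, Z (X j ω, T j ω) ^ 2 ∂P ≤ V := by
    intro j
    have hS : MeasurableSet (T j ⁻¹' Icc (t - h) (t + h)) := hM.measurable_T j measurableSet_Icc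
    calc ∫ ω, Z (X j ω, T j ω) ^ 2 ∂P
        ≤ ∫ ω, (T j ⁻¹' Icc (t - h) (t + h)).indicator (fun _ => (h⁻¹ ^ 2 * K) ^ 2) ω ∂P := by
          refine integral_mono_of_nonneg (ae_of_all _ fun ω => sq_nonneg _)
            ((integrable_const _).indicator hS) (ae_of_all _ fun ω => ?_)
          by_cases hmem : ω ∈ T j ⁻¹' Icc (t - h) (t + h)
          · simp only [indicator_of_mem hmem]
            rw [← sq_abs]
            exact pow_le_pow_left₀ (abs_nonneg _) (hZb _) 2
          · simp only [indicator_of_notMem hmem]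
            have : 1 < |(t - T j ω) / h| := by
              by_contra hcon
              exact hmem (mem_Icc_of_div_mem hh (not_lt.1 hcon))
            simp [hZ, hφ0 _ this]
      _ = PT.real (Icc (t - h) (t + h)) * (h⁻¹ ^ 2 * K) ^ 2 := by
          rw [integral_indicator_const _ hS, ← hM.law_T j,
            map_measureReal_apply (hM.measurable_T j) measurableSet_Icc, smul_eq_mul]
      _ ≤ (C * h) * (h⁻¹ ^ 2 * K) ^ 2 := by gcongr
      _ = V := by rw [hV]; field_simp
  have hb := bernstein (P := P) (Y := fun j ω => Z (X j ω, T j ω) - e) (A := 2 * (h⁻¹ ^ 2 * K))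
    (V := V) (η := η) (fun j => (hZm.comp (hpair j)).sub_const e)
    (hM.iIndepFun_prod.comp (fun _ z => Z z - e) fun _ => hZm.sub_const e)
    (fun j ω => by
      calc |Z (X j ω, T j ω) - e| ≤ |Z (X j ω, T j ω)| + |e| := abs_sub _ _
        _ ≤ _ := by linarith [hZb (X j ω, T j ω)])
    (fun j => by
      rw [integral_sub (hZi j) (integrable_const _), hEZ]; simp)
    (fun j => by
      have hZj : Measurable fun ω => Z (X j ω, T j ω) := hZm.comp (hpair j)
      have h1 := variance_le_expectation_sq (μ := P) hZj.aestronglyMeasurable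
      rw [variance_eq_integral hZj.aemeasurable, hEZ] at h1
      exact h1.trans (hsecond j))
    hVpos hη (by
      rw [hV]
      have : η * (2 * (h⁻¹ ^ 2 * K)) = 2 * (K * (η * h)) / h ^ 3 := by field_simp
      rw [this, mul_div_assoc']
      have h3 : 2 * (K * (η * h)) ≤ 2 * (K ^ 2 * C) := by
        linarith [mul_le_mul_of_nonneg_left hηh hKpos.le]
      gcongr) hn
  have hn' : (n : ℝ) ≠ 0 := by positivity
  have hexp : (n : ℝ) * η ^ 2 / (4 * V) = n * h ^ 3 * (η ^ 2 / (4 * (K ^ 2 * C))) := by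
    rw [hV]; field_simp
  rw [hexp] at hb
  convert hb using 6 with ω
  rw [kernelAverage, Finset.sum_sub_distrib, Finset.sum_const, Finset.card_range, nsmul_eq_mul,
    mul_sub, ← mul_assoc, one_div_mul_cancel hn', one_mul]

lemma abs_kernel_term_sub_le {φ : ℝ → ℝ} {w : ℝ × ℝ → ℝ} {L : ℝ}
    (hL : ∀ u v, |φ u - φ v| ≤ L * |u - v|) (hw : ∀ z, |w z| ≤ 1) {h : ℝ} (hh : 0 < h) (s t : ℝ)
    (z : ℝ × ℝ) :
    |w z * (h⁻¹ ^ 2 * φ ((t - z.2) / h)) - w z * (h⁻¹ ^ 2 * φ ((s - z.2) / h))| ≤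
      L * |t - s| / h ^ 3 := by
  rw [← mul_sub, ← mul_sub, abs_mul, abs_mul, abs_of_nonneg (by positivity : 0 ≤ h⁻¹ ^ 2)]
  have h1 := hL ((t - z.2) / h) ((s - z.2) / h)
  have h2 : (t - z.2) / h - (s - z.2) / h = (t - s) / h := by ring
  rw [h2, abs_div, abs_of_pos hh] at h1
  calc _ ≤ 1 * (h⁻¹ ^ 2 * (L * (|t - s| / h))) :=
        mul_le_mul (hw z) (by gcongr) (by positivity) one_pos.le
    _ = _ := by field_simp

/-- Uniform concentration on `[0, b]`: a union bound over a grid of mesh proportional to `h³`, on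
which the Lipschitz property of `φ` controls the oscillation. -/
lemma kernelAverage_uniform_concentration {Ω : Type*} [MeasurableSpace Ω] {P : Measure Ω}
    [IsProbabilityMeasure P] {X T : ℕ → Ω → ℝ} {PX PT : Measure ℝ} (hM : Model P X T PX PT)
    {φ : ℝ → ℝ} {w : ℝ × ℝ → ℝ} {K L C b h η : ℝ} (hφ : Measurable φ) (hwm : Measurable w)
    (hK : ∀ u, |φ u| ≤ K) (hKpos : 0 < K) (hφ0 : ∀ u, 1 < |u| → φ u = 0) (hw : ∀ z, |w z| ≤ 1)
    (hL : ∀ u v, |φ u - φ v| ≤ L * |u - v|) (hLpos : 0 < L)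
    (hC : 0 < C) (hh : 0 < h) (hPT : ∀ t ∈ Icc 0 b, PT.real (Icc (t - h) (t + h)) ≤ C * h)
    (hη : 0 < η) (hηh : η * h ≤ K * C) {n : ℕ} (hn : 0 < n) (hb : 0 ≤ b) :
    P.real {ω | ∃ t ∈ Icc 0 b, 2 * η < |kernelAverage φ w h n (fun j => X j ω) (fun j => T j ω) t -
        kernelMean φ w PX PT h t|} ≤
      (2 * L * b / (η * h ^ 3) + 1) *
        (2 * Real.exp (-(n * h ^ 3 * (η ^ 2 / (4 * (K ^ 2 * C)))))) := by
  obtain ⟨hPX, hPT'⟩ := hM.isProbabilityMeasure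
  have hn' : (0 : ℝ) < n := by exact_mod_cast hn
  set μ := η * h ^ 3 / (2 * L) with hμ
  have hμpos : 0 < μ := by positivity
  have hosc1 : ∀ x y : ℕ → ℝ, ∀ s t : ℝ, |t - s| ≤ μ →
      |kernelAverage φ w h n x y t - kernelAverage φ w h n x y s| ≤ η / 2 := by
    intro x y s t hst
    rw [kernelAverage, kernelAverage, ← mul_sub, ← Finset.sum_sub_distrib, abs_mul,
      abs_of_pos (by positivity)]
    calc _ ≤ 1 / (n : ℝ) * ∑ j ∈ Finset.range n, L * |t - s| / h ^ 3 := by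
          gcongr
          exact (Finset.abs_sum_le_sum_abs _ _).trans
            (Finset.sum_le_sum fun j _ => abs_kernel_term_sub_le hL hw hh s t _)
      _ = L * |t - s| / h ^ 3 := by
          rw [Finset.sum_const, Finset.card_range, nsmul_eq_mul]; field_simp
      _ ≤ L * μ / h ^ 3 := by gcongr
      _ = η / 2 := by rw [hμ]; field_simp
  have hint : ∀ t, Integrable (fun z : ℝ × ℝ => w z * (h⁻¹ ^ 2 * φ ((t - z.2) / h)))
      (PX.prod PT) := fun t =>
    Integrable.of_bound (measurable_kernel_term hφ hwm h t).aestronglyMeasurable _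
      (ae_of_all _ (abs_kernel_term_le hK hw h t))
  have hosc2 : ∀ s t : ℝ, |t - s| ≤ μ →
      |kernelMean φ w PX PT h t - kernelMean φ w PX PT h s| ≤ η / 2 := by
    intro s t hst
    rw [kernelMean, kernelMean, ← integral_sub (hint t) (hint s)]
    calc _ ≤ L * |t - s| / h ^ 3 := by
          have := norm_integral_le_of_norm_le_const (μ := PX.prod PT)
            (f := fun z : ℝ × ℝ => w z * (h⁻¹ ^ 2 * φ ((t - z.2) / h)) -
              w z * (h⁻¹ ^ 2 * φ ((s - z.2) / h)))
            (ae_of_all _ (abs_kernel_term_sub_le hL hw hh s t))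
          simpa using this
      _ ≤ L * μ / h ^ 3 := by gcongr
      _ = η / 2 := by rw [hμ]; field_simp
  set N := ⌊b / μ⌋₊ with hN
  have hgrid : ∀ i ∈ Finset.range (N + 1), (i : ℝ) * μ ∈ Icc 0 b := by
    intro i hi
    refine ⟨by positivity, ?_⟩
    have h1 : (i : ℝ) ≤ N := by exact_mod_cast Nat.lt_succ_iff.1 (Finset.mem_range.1 hi)
    have h2 : (N : ℝ) ≤ b / μ := Nat.floor_le (by positivity)
    exact (le_div_iff₀ hμpos).1 (h1.trans h2)
  set D : ℝ → Ω → ℝ := fun t ω => |kernelAverage φ w h n (fun j => X j ω) (fun j => T j ω) t -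
        kernelMean φ w PX PT h t| with hD
  have hsub : {ω | ∃ t ∈ Icc 0 b, 2 * η < D t ω} ⊆
      ⋃ i ∈ Finset.range (N + 1), {ω | η ≤ D (i * μ) ω} := by
    rintro ω ⟨t, ht, hω⟩
    simp only [mem_iUnion]
    refine ⟨⌊t / μ⌋₊, ?_, ?_⟩
    · rw [Finset.mem_range, Nat.lt_succ_iff]
      exact Nat.floor_le_floor (by gcongr; exact ht.2)
    · have h1 : (⌊t / μ⌋₊ : ℝ) * μ ≤ t :=
        (le_div_iff₀ hμpos).1 (Nat.floor_le (div_nonneg ht.1 hμpos.le))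
      have h2 : t < (⌊t / μ⌋₊ + 1 : ℝ) * μ := (div_lt_iff₀ hμpos).1 (Nat.lt_floor_add_one _)
      have h3 : |t - ⌊t / μ⌋₊ * μ| ≤ μ := by
        rw [abs_of_nonneg (by linarith)]; linarith
      have k1 := hosc1 (fun j => X j ω) (fun j => T j ω) _ _ h3
      have k2 := hosc2 _ _ h3
      simp only [hD, mem_ofPred_eq] at hω ⊢
      rw [abs_le] at k1 k2
      rcases lt_abs.1 hω with h4 | h4
      · refine le_trans ?_ (le_abs_self _)
        linarith
      · refine le_trans ?_ (neg_le_abs _)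
        linarith
  calc P.real {ω | ∃ t ∈ Icc 0 b, 2 * η < D t ω}
      ≤ P.real (⋃ i ∈ Finset.range (N + 1), {ω | η ≤ D (i * μ) ω}) :=
        measureReal_mono hsub (measure_ne_top _ _)
    _ ≤ ∑ i ∈ Finset.range (N + 1), P.real {ω | η ≤ D (i * μ) ω} :=
        measureReal_biUnion_finset_le _ _
    _ ≤ ∑ i ∈ Finset.range (N + 1),
          2 * Real.exp (-(n * h ^ 3 * (η ^ 2 / (4 * (K ^ 2 * C))))) :=
        Finset.sum_le_sum fun i hi => kernelAverage_concentration hM hφ hwm hK hKpos hφ0 hw hC hh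
          (hPT _ (hgrid i hi)) hη.le hηh hn
    _ = (N + 1) * (2 * Real.exp (-(n * h ^ 3 * (η ^ 2 / (4 * (K ^ 2 * C)))))) := by
        rw [Finset.sum_const, Finset.card_range, nsmul_eq_mul]; push_cast; ring
    _ ≤ _ := by
        gcongr
        calc (N : ℝ) ≤ b / μ := Nat.floor_le (by positivity)
          _ = _ := by rw [hμ]; field_simp

/-! ### Events of probability tending to one -/

/-- The event `E n` has probability tending to one. The (outer) measure of its complement is used,
so that no measurability is needed. -/
def WHP {Ω : Type*} [MeasurableSpace Ω] (P : Measure Ω) (E : ℕ → Ω → Prop) : Prop :=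
  Tendsto (fun n => P {ω | ¬E n ω}) atTop (𝓝 0)

lemma WHP.mono {Ω : Type*} [MeasurableSpace Ω] {P : Measure Ω} {E E' : ℕ → Ω → Prop}
    (h : WHP P E) (hE : ∀ᶠ n in atTop, ∀ ω, E n ω → E' n ω) : WHP P E' := by
  refine tendsto_of_tendsto_of_tendsto_of_le_of_le' tendsto_const_nhds h
    (Eventually.of_forall fun _ => zero_le) ?_
  filter_upwards [hE] with n hn
  exact measure_mono fun ω hω hE => hω (hn ω hE)

lemma WHP.and {Ω : Type*} [MeasurableSpace Ω] {P : Measure Ω} {E E' : ℕ → Ω → Prop}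
    (h : WHP P E) (h' : WHP P E') : WHP P fun n ω => E n ω ∧ E' n ω := by
  have := h.add h'
  rw [add_zero] at this
  refine tendsto_of_tendsto_of_tendsto_of_le_of_le tendsto_const_nhds this
    (fun _ => zero_le) fun n => ?_
  refine (measure_mono fun ω hω => ?_).trans (measure_union_le _ _)
  exact not_and_or.1 hω

lemma WHP.of_ae {Ω : Type*} [MeasurableSpace Ω] {P : Measure Ω} {E : ℕ → Ω → Prop}
    (h : ∀ n, ∀ᵐ ω ∂P, E n ω) : WHP P E := by
  have : (fun n => P {ω | ¬E n ω}) = fun _ => 0 := funext fun n => h n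
  rw [WHP, this]
  exact tendsto_const_nhds

lemma WHP.of_real_le {Ω : Type*} [MeasurableSpace Ω] {P : Measure Ω} [IsProbabilityMeasure P]
    {E : ℕ → Ω → Prop} {u : ℕ → ℝ} (hu : Tendsto u atTop (𝓝 0))
    (h : ∀ᶠ n in atTop, P.real {ω | ¬E n ω} ≤ u n) : WHP P E := by
  have h1 : Tendsto (fun n => P.real {ω | ¬E n ω}) atTop (𝓝 0) :=
    tendsto_of_tendsto_of_tendsto_of_le_of_le' tendsto_const_nhds hu
      (Eventually.of_forall fun _ => measureReal_nonneg) h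
  have h2 := ENNReal.tendsto_ofReal h1
  simpa [WHP, ofReal_measureReal] using h2

lemma WHP.tendsto_one {Ω : Type*} [MeasurableSpace Ω] {P : Measure Ω} [IsProbabilityMeasure P]
    {E : ℕ → Ω → Prop} (h : WHP P E) : Tendsto (fun n => P {ω | E n ω}) atTop (𝓝 1) := by
  have h1 : Tendsto (fun n => 1 - P {ω | ¬E n ω}) atTop (𝓝 (1 - 0)) :=
    ENNReal.Tendsto.sub tendsto_const_nhds h (Or.inl ENNReal.one_ne_top)
  rw [tsub_zero] at h1
  refine tendsto_of_tendsto_of_tendsto_of_le_of_le h1 tendsto_const_nhds (fun n => ?_)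
    fun n => prob_le_one
  rw [tsub_le_iff_right]
  calc (1 : ENNReal) = P univ := measure_univ.symm
    _ ≤ P ({ω | E n ω} ∪ {ω | ¬E n ω}) := measure_mono fun ω _ => em (E n ω)
    _ ≤ _ := measure_union_le _ _

/-- Sequences of variables that agree with probability tending to one converge in law to the same
limits. -/
lemma WHP.convergesInLaw {Ω : Type*} [MeasurableSpace Ω] {P : Measure Ω} [IsProbabilityMeasure P]
    {Y Z : ℕ → Ω → ℝ} (h : WHP P fun n ω => Y n ω = Z n ω) {L : Measure ℝ}
    (hY : ConvergesInLaw P Y L) : ConvergesInLaw P Z L := by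
  intro z hz
  have h0 : Tendsto (fun n => P.real {ω | ¬Y n ω = Z n ω}) atTop (𝓝 0) := by
    have := (ENNReal.tendsto_toReal ENNReal.zero_ne_top).comp h
    simpa [Measure.real, Function.comp_def] using this
  have hle : ∀ U V : ℕ → Ω → ℝ, ∀ n, P.real {ω | U n ω ≤ z} ≤
      P.real {ω | V n ω ≤ z} + P.real {ω | ¬U n ω = V n ω} := by
    intro U V n
    refine (measureReal_mono fun ω hω => ?_).trans (measureReal_union_le _ _)
    by_cases hUV : U n ω = V n ω
    · exact Or.inl (by simpa [← hUV] using hω)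
    · exact Or.inr hUV
  have h1 := (hY z hz).sub h0
  have h2 := (hY z hz).add h0
  rw [sub_zero] at h1
  rw [add_zero] at h2
  refine tendsto_of_tendsto_of_tendsto_of_le_of_le h1 h2 (fun n => ?_) fun n => ?_
  · have := hle Y Z n
    simp only
    linarith
  · have := hle Z Y n
    simp only [eq_comm (a := Z n _)] at this
    exact this

/-! ### The bandwidth -/

lemma bandwidth_pos {c α : ℝ} (hc : 0 < c) {n : ℕ} (hn : 0 < n) : 0 < bandwidth c α n := by
  have : (0 : ℝ) < n := by exact_mod_cast hn
  rw [bandwidth]; positivity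

lemma tendsto_bandwidth {c α : ℝ} (hα : 0 < α) : Tendsto (bandwidth c α) atTop (𝓝 0) := by
  have h1 := (tendsto_rpow_neg_atTop hα).comp tendsto_natCast_atTop_atTop
  have h2 := h1.const_mul c
  rwa [mul_zero] at h2

/-- As `n h³` is a positive power of `n`, the exponential beats the number of grid points. -/
lemma tendsto_grid_mul_exp {c α : ℝ} (hc : 0 < c) (hα : α ∈ Ioo (0 : ℝ) (1 / 3)) (A : ℝ) {γ : ℝ}
    (hγ : 0 < γ) :
    Tendsto (fun n : ℕ => (A / bandwidth c α n ^ 3 + 1) *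
      (2 * Real.exp (-(n * bandwidth c α n ^ 3 * γ)))) atTop (𝓝 0) := by
  obtain ⟨hα0, hα1⟩ := hα
  have hp : 0 < 1 - 3 * α := by linarith
  have hx : Tendsto (fun n : ℕ => (n : ℝ) ^ (1 - 3 * α)) atTop atTop :=
    (tendsto_rpow_atTop hp).comp tendsto_natCast_atTop_atTop
  have h1 := (tendsto_rpow_mul_exp_neg_mul_atTop_nhds_zero (3 * α / (1 - 3 * α)) (c ^ 3 * γ)
    (by positivity)).comp hx
  have h2 := (tendsto_rpow_mul_exp_neg_mul_atTop_nhds_zero 0 (c ^ 3 * γ) (by positivity)).comp hx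
  have h3 := (h1.const_mul (2 * A / c ^ 3)).add (h2.const_mul 2)
  simp only [mul_zero, add_zero] at h3
  refine h3.congr' ?_
  filter_upwards [eventually_gt_atTop 0] with n hn
  have hn' : (0 : ℝ) < n := by exact_mod_cast hn
  have e1 : ((n : ℝ) ^ (1 - 3 * α)) ^ (3 * α / (1 - 3 * α)) = (n : ℝ) ^ (3 * α) := by
    rw [← Real.rpow_mul hn'.le, mul_div_cancel₀ _ hp.ne']
  have e2 : bandwidth c α n ^ 3 = c ^ 3 * ((n : ℝ) ^ (3 * α))⁻¹ := by
    rw [bandwidth, mul_pow, ← Real.rpow_natCast (_ ^ (-α)), ← Real.rpow_mul hn'.le,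
      ← Real.rpow_neg hn'.le]
    congr 2
    push_cast
    ring
  have e3 : (n : ℝ) * bandwidth c α n ^ 3 = c ^ 3 * (n : ℝ) ^ (1 - 3 * α) := by
    rw [e2, Real.rpow_sub hn', Real.rpow_one]
    ring
  have hpos : 0 < (n : ℝ) ^ (3 * α) := by positivity
  simp only [Function.comp_apply, e1, Real.rpow_zero]
  rw [e3, e2]
  have e4 : -(c ^ 3 * γ) * (n : ℝ) ^ (1 - 3 * α) = -(c ^ 3 * (n : ℝ) ^ (1 - 3 * α) * γ) := by ring
  rw [e4]
  generalize Real.exp _ = E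
  field_simp

/-- With bandwidth `c n^{-α}`, `α < 1/3`, kernel averages converge uniformly to their means, with
probability tending to one. -/
lemma whp_kernelAverage {Ω : Type*} [MeasurableSpace Ω] {P : Measure Ω} [IsProbabilityMeasure P]
    {X T : ℕ → Ω → ℝ} {PX PT : Measure ℝ} (hM : Model P X T PX PT) {φ : ℝ → ℝ} {w : ℝ × ℝ → ℝ}
    {K L C b h₀ c α η : ℝ} (hφ : Measurable φ) (hwm : Measurable w) (hK : ∀ u, |φ u| ≤ K)
    (hφ0 : ∀ u, 1 < |u| → φ u = 0) (hw : ∀ z, |w z| ≤ 1)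
    (hL : ∀ u v, |φ u - φ v| ≤ L * |u - v|) (hh₀ : 0 < h₀)
    (hPT : ∀ t ∈ Icc 0 b, ∀ h ∈ Ioc 0 h₀, PT.real (Icc (t - h) (t + h)) ≤ C * h)
    (hc : 0 < c) (hα : α ∈ Ioo (0 : ℝ) (1 / 3)) (hb : 0 ≤ b) (hη : 0 < η) :
    WHP P fun n ω => ∀ t ∈ Icc 0 b,
      |kernelAverage φ w (bandwidth c α n) n (fun j => X j ω) (fun j => T j ω) t -
        kernelMean φ w PX PT (bandwidth c α n) t| ≤ η := by
  set K' := max K 1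
  set L' := max L 1
  set C' := max C 1
  have hK' : 0 < K' := lt_max_of_lt_right one_pos
  have hL' : 0 < L' := lt_max_of_lt_right one_pos
  have hC' : 0 < C' := lt_max_of_lt_right one_pos
  have hη2 : 0 < η / 2 := half_pos hη
  refine WHP.of_real_le (tendsto_grid_mul_exp hc hα (2 * L' * b / (η / 2))
    (γ := (η / 2) ^ 2 / (4 * (K' ^ 2 * C'))) (by positivity)) ?_
  have hlim := tendsto_bandwidth (c := c) hα.1
  filter_upwards [eventually_gt_atTop 0, hlim.eventually_le_const hh₀,
    hlim.eventually_le_const (show 0 < K' * C' / (η / 2) by positivity)] with n hn h1 h2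
  have hpos := bandwidth_pos (α := α) hc hn
  have := kernelAverage_uniform_concentration hM (b := b) (η := η / 2) (n := n) hφ hwm
    (fun u => (hK u).trans (le_max_left K 1)) hK' hφ0 hw
    (fun u v => (hL u v).trans (by gcongr; exact le_max_left L 1)) hL' hC' hpos
    (fun t ht => (hPT t ht _ ⟨hpos, h1⟩).trans (by gcongr; exact le_max_left C 1)) hη2
    (by rw [le_div_iff₀ hη2] at h2; linarith) hn hb
  rw [div_div]
  convert this using 4 with ω
  push Not
  simp only [mul_div_cancel₀ η (two_ne_zero' ℝ)]

/-! ### Kernels -/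

lemma ConditionK1.eq_zero {k : ℝ → ℝ} (hK : ConditionK1 k) {u : ℝ} (hu : 1 < |u|) : k u = 0 := by
  refine image_eq_zero_of_notMem_tsupport fun h => ?_
  rw [hK.support_eq] at h
  exact (abs_le.2 h).not_gt hu

lemma ConditionK1.deriv_eq_zero {k : ℝ → ℝ} (hK : ConditionK1 k) {u : ℝ} (hu : 1 < |u|) :
    deriv k u = 0 := by
  by_contra h
  have := support_deriv_subset (f := k) h
  rw [hK.support_eq] at this
  exact (abs_le.2 this).not_gt hu

lemma ConditionK1.hasCompactSupport {k : ℝ → ℝ} (hK : ConditionK1 k) : HasCompactSupport k := by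
  rw [HasCompactSupport, hK.support_eq]
  exact isCompact_Icc

lemma ConditionK1.hasDerivAt {k : ℝ → ℝ} (hK : ConditionK1 k) (u : ℝ) :
    HasDerivAt k (deriv k u) u :=
  ((hK.contDiff.differentiable (by norm_num)) u).hasDerivAt

lemma ConditionK1.contDiff_deriv {k : ℝ → ℝ} (hK : ConditionK1 k) : ContDiff ℝ 1 (deriv k) := by
  have := hK.contDiff
  rw [show (2 : WithTop ℕ∞) = 1 + 1 by norm_num, contDiff_succ_iff_deriv] at this
  exact this.2.2

/-- A `C¹` function with compact support is bounded and Lipschitz. -/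
lemma exists_bound_of_hasCompactSupport {φ : ℝ → ℝ} (hφ : ContDiff ℝ 1 φ)
    (hs : HasCompactSupport φ) :
    ∃ K > 0, (∀ u, |φ u| ≤ K) ∧ ∀ u v, |φ u - φ v| ≤ K * |u - v| := by
  obtain ⟨K, hK⟩ := hs.exists_bound_of_continuous hφ.continuous
  obtain ⟨L, hL⟩ := hφ.lipschitzWith_of_hasCompactSupport hs (by norm_num)
  refine ⟨max 1 (max K L), by positivity, fun u => ?_, fun u v => ?_⟩
  · exact (hK u).trans ((le_max_left _ _).trans (le_max_right _ _))
  · have := hL.dist_le_mul u v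
    rw [Real.dist_eq, Real.dist_eq] at this
    refine this.trans ?_
    gcongr
    exact (le_max_right _ _).trans (le_max_right _ _)

lemma ConditionK1.exists_bound {k : ℝ → ℝ} (hK : ConditionK1 k) :
    ∃ K > 0, ((∀ u, |k u| ≤ K) ∧ ∀ u v, |k u - k v| ≤ K * |u - v|) ∧
      (∀ u, |deriv k u| ≤ K) ∧ ∀ u v, |deriv k u - deriv k v| ≤ K * |u - v| := by
  obtain ⟨K, hKpos, h1, h2⟩ :=
    exists_bound_of_hasCompactSupport (hK.contDiff.of_le (by norm_num)) hK.hasCompactSupport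
  obtain ⟨L, -, h3, h4⟩ :=
    exists_bound_of_hasCompactSupport hK.contDiff_deriv hK.hasCompactSupport.deriv
  refine ⟨max K L, lt_max_of_lt_left hKpos, ⟨fun u => (h1 u).trans (le_max_left _ _),
    fun u v => (h2 u v).trans (by gcongr; exact le_max_left _ _)⟩,
    fun u => (h3 u).trans (le_max_right _ _),
    fun u v => (h4 u v).trans (by gcongr; exact le_max_right _ _)⟩

lemma ConditionK1.exists_pos {k : ℝ → ℝ} (hK : ConditionK1 k) : ∃ u ∈ Ioc (1 / 2) 1, 0 < k u := by
  have h1 : (1 : ℝ) ∈ closure (Function.support k) := by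
    have : (1 : ℝ) ∈ tsupport k := by rw [hK.support_eq]; constructor <;> norm_num
    exact this
  obtain ⟨u, hu, hku⟩ := mem_closure_iff.1 h1 (Ioi (1 / 2)) isOpen_Ioi
    (by simp only [mem_Ioi]; norm_num)
  have hpos : 0 < k u := lt_of_le_of_ne (hK.nonneg u) (Ne.symm hku)
  refine ⟨u, ⟨hu, ?_⟩, hpos⟩
  by_contra hcon
  exact hku (hK.eq_zero ((not_le.1 hcon).trans_le (le_abs_self u)))

lemma ConditionK1.upper_half_mass_pos {k : ℝ → ℝ} (hK : ConditionK1 k) :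
    0 < ∫ u in (1 / 2)..1, k u := by
  obtain ⟨u, hu, hpos⟩ := hK.exists_pos
  exact intervalIntegral.integral_pos (by norm_num) hK.contDiff.continuous.continuousOn
    (fun v _ => hK.nonneg v) ⟨u, Ioc_subset_Icc_self hu, hpos⟩

lemma continuous_nu {k : ℝ → ℝ} (hk : Continuous k) (i : ℕ) : Continuous (nu k i) :=
  intervalIntegral.continuous_primitive
    (fun _ _ => (by fun_prop : Continuous fun u => u ^ i * k u).intervalIntegrable _ _) _

/-- The denominator of the boundary kernel is positive: by Cauchy-Schwarz it is nonnegative, and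
`k` is not concentrated at a point of `[-1, 0]`. -/
lemma ConditionK1.nu_det_pos {k : ℝ → ℝ} (hK : ConditionK1 k) {β : ℝ} (hβ : 0 ≤ β) :
    0 < nu k 0 β * nu k 2 β - nu k 1 β ^ 2 := by
  have hc : Continuous k := hK.contDiff.continuous
  obtain ⟨u, hu, hpos⟩ := hK.exists_pos
  have hβ' : -1 < β := by linarith
  have hpos' : 0 < k (-u) := by rwa [hK.symmetric]
  have h0 : 0 < nu k 0 β := by
    refine intervalIntegral.integral_pos hβ' (by fun_prop)
      (fun v _ => mul_nonneg (by simp) (hK.nonneg v)) ⟨-u, ⟨by linarith [hu.2], by linarith [hu.1]⟩,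
        by simpa using hpos'⟩
  set x := nu k 1 β / nu k 0 β with hx
  have hx' : nu k 1 β = x * nu k 0 β := by rw [hx, div_mul_cancel₀ _ h0.ne']
  have hne : ∃ v ∈ Icc (-1) β, 0 < (v - x) ^ 2 * k v := by
    have hnear : ∀ᶠ v in 𝓝 (-u), 0 < k v ∧ v < 0 :=
      (hc.continuousAt.eventually (lt_mem_nhds hpos')).and (gt_mem_nhds (by linarith [hu.1]))
    obtain ⟨v, ⟨hv1, hv2⟩, hvx⟩ : ∃ v, (0 < k v ∧ v < 0) ∧ v ≠ x := by
      by_cases hux : -u = x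
      · obtain ⟨v, hv, hvne⟩ :=
          ((hnear.filter_mono nhdsWithin_le_nhds).and
            (self_mem_nhdsWithin : {-u}ᶜ ∈ 𝓝[≠] (-u))).exists
        exact ⟨v, hv, by rw [← hux]; exact hvne⟩
      · exact ⟨-u, hnear.self_of_nhds, hux⟩
    have hvabs : |v| ≤ 1 := by
      by_contra hcon
      exact hv1.ne' (hK.eq_zero (not_le.1 hcon))
    refine ⟨v, ⟨(abs_le.1 hvabs).1, by linarith⟩, mul_pos ?_ hv1⟩
    exact sq_pos_of_ne_zero (sub_ne_zero.2 hvx)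
  have hvar : 0 < ∫ v in (-1)..β, (v - x) ^ 2 * k v :=
    intervalIntegral.integral_pos hβ' (by fun_prop)
      (fun v _ => mul_nonneg (sq_nonneg _) (hK.nonneg v)) hne
  have hi : ∀ i : ℕ, IntervalIntegrable (fun v => v ^ i * k v) volume (-1) β := fun i =>
    (by fun_prop : Continuous fun v => v ^ i * k v).intervalIntegrable _ _
  have hexp : ∫ v in (-1)..β, (v - x) ^ 2 * k v =
      nu k 2 β - 2 * x * nu k 1 β + x ^ 2 * nu k 0 β := by
    rw [nu, nu, nu, ← intervalIntegral.integral_const_mul, ← intervalIntegral.integral_const_mul,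
      ← intervalIntegral.integral_sub (hi 2) ((hi 1).const_mul _),
      ← intervalIntegral.integral_add ((hi 2).sub ((hi 1).const_mul _)) ((hi 0).const_mul _)]
    exact intervalIntegral.integral_congr fun v _ => by ring
  rw [hexp, hx'] at hvar
  rw [hx']
  calc 0 < nu k 0 β * (nu k 2 β - 2 * x * (x * nu k 0 β) + x ^ 2 * nu k 0 β) := mul_pos h0 hvar
    _ = _ := by ring

lemma ConditionK1.exists_bound_kernelAt {k : ℝ → ℝ} (hK : ConditionK1 k) :
    ∃ C > 0, ∀ h > 0, ∀ t ≥ 0, ∀ v, |kernelAt k h t v| ≤ C := by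
  obtain ⟨K, hKpos, ⟨hb, -⟩, -⟩ := hK.exists_bound
  have hν := continuous_nu hK.contDiff.continuous
  have hcont : ContinuousOn (fun β => (|nu k 2 β| + |nu k 1 β|) /
      (nu k 0 β * nu k 2 β - nu k 1 β ^ 2)) (Icc 0 1) := by
    refine ContinuousOn.div ?_ ?_ fun β hβ => (hK.nu_det_pos hβ.1).ne'
    · exact ((hν 2).abs.add (hν 1).abs).continuousOn
    · exact (((hν 0).mul (hν 2)).sub ((hν 1).pow 2)).continuousOn
  obtain ⟨D, hD⟩ := isCompact_Icc.exists_bound_of_continuousOn hcont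
  refine ⟨max K (D * K), lt_max_of_lt_left hKpos, fun h hh t ht v => ?_⟩
  rw [kernelAt]
  split_ifs with hth
  · refine le_trans ?_ (le_max_right _ _)
    have hβ : t / h ∈ Icc (0 : ℝ) 1 := ⟨by positivity, (div_le_one hh).2 hth⟩
    have hD' := hD _ hβ
    have hD0 : 0 ≤ D := (norm_nonneg _).trans hD'
    by_cases hv : v ∈ Ioo (-1) (t / h)
    · rw [boundaryKernel, indicator_of_mem hv, abs_mul]
      refine mul_le_mul ?_ (hb v) (abs_nonneg _) hD0
      rw [Real.norm_eq_abs, abs_div] at hD'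
      rw [abs_div]
      refine le_trans ?_ hD'
      have hv1 : |v| ≤ 1 := abs_le.2 ⟨hv.1.le, hv.2.le.trans hβ.2⟩
      refine div_le_div_of_nonneg_right ?_ (abs_nonneg _)
      calc |nu k 2 (t / h) - nu k 1 (t / h) * v|
          ≤ |nu k 2 (t / h)| + |nu k 1 (t / h) * v| := abs_sub _ _
        _ ≤ |nu k 2 (t / h)| + |nu k 1 (t / h)| * 1 := by rw [abs_mul]; gcongr
        _ ≤ _ := by rw [mul_one]; exact le_abs_self _
    · rw [boundaryKernel, indicator_of_notMem hv, abs_zero]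
      positivity
  · exact (hb v).trans (le_max_left _ _)

lemma ConditionK1.measurable_kernelAt {k : ℝ → ℝ} (hK : ConditionK1 k) (h y : ℝ) :
    Measurable fun t => kernelAt k h t ((t - y) / h) := by
  have hν := fun i => (continuous_nu hK.contDiff.continuous i).measurable
  have hk := hK.contDiff.continuous.measurable
  have hm : ∀ i, Measurable fun t : ℝ => nu k i (t / h) := fun i =>
    (hν i).comp (measurable_id.div_const h)
  have e : (fun t => kernelAt k h t ((t - y) / h)) = fun t => if t ≤ h then
      (if -1 < (t - y) / h ∧ (t - y) / h < t / h then
        (nu k 2 (t / h) - nu k 1 (t / h) * ((t - y) / h)) /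
          (nu k 0 (t / h) * nu k 2 (t / h) - nu k 1 (t / h) ^ 2) * k ((t - y) / h) else 0)
      else k ((t - y) / h) := by
    funext t
    rw [kernelAt]
    by_cases h1 : t ≤ h
    · rw [if_pos h1, if_pos h1, boundaryKernel]
      by_cases h2 : (t - y) / h ∈ Ioo (-1) (t / h)
      · rw [indicator_of_mem h2, if_pos (And.intro h2.1 h2.2)]
      · rw [indicator_of_notMem h2, if_neg fun hand => h2 ⟨hand.1, hand.2⟩]
    · rw [if_neg h1, if_neg h1]
  rw [e]
  refine Measurable.ite measurableSet_Iic (Measurable.ite ?_ ?_ measurable_const) ?_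
  · exact (measurableSet_lt measurable_const (by fun_prop : Measurable fun t => (t - y) / h)).inter
      (measurableSet_lt (by fun_prop : Measurable fun t => (t - y) / h)
        (by fun_prop : Measurable fun t : ℝ => t / h))
  · exact ((((hm 2).sub ((hm 1).mul (by fun_prop))).div
      (((hm 0).mul (hm 2)).sub ((hm 1).pow_const 2))).mul (hk.comp (by fun_prop)))
  · exact hk.comp (by fun_prop)

lemma ConditionK1.kernelAt_eq_zero {k : ℝ → ℝ} (hK : ConditionK1 k) {h t y : ℝ} (hh : 0 < h)
    (hy : t + h < y) : kernelAt k h t ((t - y) / h) = 0 := by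
  have h1 : (t - y) / h < -1 := by rw [div_lt_iff₀ hh]; linarith
  rw [kernelAt]
  split_ifs
  · exact indicator_of_notMem (fun hmem => h1.not_gt hmem.1) _
  · exact hK.eq_zero (lt_of_lt_of_le (by linarith) (neg_le_abs _))

/-! ### The estimators -/

/-- The indicator of `Δ = i`, as a weight on pairs of event and inspection times. -/
def statusWeight (i : Fin 2) (z : ℝ × ℝ) : ℝ := if delta z.1 z.2 = i then 1 else 0

lemma measurable_statusWeight (i : Fin 2) : Measurable (statusWeight i) := by
  have hd : Measurable fun z : ℝ × ℝ => delta z.1 z.2 :=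
    Measurable.ite (measurableSet_le measurable_fst measurable_snd) measurable_const
      measurable_const
  exact Measurable.ite (hd (measurableSet_singleton i)) measurable_const measurable_const

lemma statusWeight_nonneg (i : Fin 2) (z : ℝ × ℝ) : 0 ≤ statusWeight i z := by
  rw [statusWeight]; split_ifs <;> norm_num

lemma abs_statusWeight_le (i : Fin 2) (z : ℝ × ℝ) : |statusWeight i z| ≤ 1 := by
  rw [statusWeight]; split_ifs <;> norm_num

lemma statusWeight_add (z : ℝ × ℝ) : statusWeight 0 z + statusWeight 1 z = 1 := by
  rw [statusWeight, statusWeight]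
  rw [delta]
  split_ifs <;> simp_all

lemma gHatSub_eq_sum (k : ℝ → ℝ) (h : ℝ) (n : ℕ) (x y : ℕ → ℝ) (i : Fin 2) (t : ℝ) :
    gHatSub k h n x y i t = (1 / (n : ℝ)) * ∑ j ∈ Finset.range n,
      statusWeight i (x j, y j) * ((1 / h) * kernelAt k h t ((t - y j) / h)) := by
  simp only [gHatSub, statusWeight, ite_mul, one_mul, zero_mul]

lemma gHatSub_eq_kernelAverage (k : ℝ → ℝ) {h : ℝ} (hh : 0 < h) (n : ℕ) (x y : ℕ → ℝ) (i : Fin 2)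
    {t : ℝ} (ht : h < t) :
    gHatSub k h n x y i t = h * kernelAverage k (statusWeight i) h n x y t := by
  rw [gHatSub_eq_sum, kernelAverage, mul_left_comm]
  congr 1
  rw [Finset.mul_sum]
  refine Finset.sum_congr rfl fun j _ => ?_
  rw [kernelAt, if_neg ht.not_ge]
  field_simp

lemma kernelAverage_add (φ : ℝ → ℝ) (h : ℝ) (n : ℕ) (x y : ℕ → ℝ) (t : ℝ) :
    kernelAverage φ (statusWeight 0) h n x y t + kernelAverage φ (statusWeight 1) h n x y t =
      kernelAverage φ (fun _ => 1) h n x y t := by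
  simp only [kernelAverage]
  rw [← mul_add, ← Finset.sum_add_distrib]
  simp only [← add_mul, statusWeight_add]

lemma gHat_eq_kernelAverage (k : ℝ → ℝ) {h : ℝ} (hh : 0 < h) (n : ℕ) (x y : ℕ → ℝ) {t : ℝ}
    (ht : h < t) : gHat k h n x y t = h * kernelAverage k (fun _ => 1) h n x y t := by
  rw [gHat, gHatSub_eq_kernelAverage k hh n x y 0 ht, gHatSub_eq_kernelAverage k hh n x y 1 ht,
    ← mul_add, kernelAverage_add]

lemma ConditionK1.hasDerivAt_kernelAverage {k : ℝ → ℝ} (hK : ConditionK1 k) (w : ℝ × ℝ → ℝ) {h : ℝ}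
    (hh : 0 < h) (n : ℕ) (x y : ℕ → ℝ) (t : ℝ) :
    HasDerivAt (fun t => h * kernelAverage k w h n x y t)
      (kernelAverage (deriv k) w h n x y t) t := by
  have hterm : ∀ j, HasDerivAt (fun t => w (x j, y j) * (h⁻¹ ^ 2 * k ((t - y j) / h)))
      (w (x j, y j) * (h⁻¹ ^ 2 * (deriv k ((t - y j) / h) * (1 / h)))) t := fun j =>
    (((hK.hasDerivAt _).comp t (((hasDerivAt_id t).sub_const (y j)).div_const h)).const_mul
      _).const_mul _
  have := ((HasDerivAt.fun_sum fun j (_ : j ∈ Finset.range n) => hterm j).const_mul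
    (1 / (n : ℝ))).const_mul h
  refine this.congr_deriv ?_
  rw [kernelAverage, mul_left_comm, Finset.mul_sum]
  congr 1
  refine Finset.sum_congr rfl fun j _ => ?_
  field_simp

lemma ConditionK1.hasDerivAt_gHatSub {k : ℝ → ℝ} (hK : ConditionK1 k) {h : ℝ} (hh : 0 < h) (n : ℕ)
    (x y : ℕ → ℝ) (i : Fin 2) {t : ℝ} (ht : h < t) :
    HasDerivAt (gHatSub k h n x y i) (kernelAverage (deriv k) (statusWeight i) h n x y t) t := by
  refine (hK.hasDerivAt_kernelAverage _ hh n x y t).congr_of_eventuallyEq ?_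
  filter_upwards [lt_mem_nhds ht] with s hs
  exact gHatSub_eq_kernelAverage k hh n x y i hs

lemma ConditionK1.hasDerivAt_gHat {k : ℝ → ℝ} (hK : ConditionK1 k) {h : ℝ} (hh : 0 < h) (n : ℕ)
    (x y : ℕ → ℝ) {t : ℝ} (ht : h < t) :
    HasDerivAt (gHat k h n x y) (kernelAverage (deriv k) (fun _ => 1) h n x y t) t := by
  refine (hK.hasDerivAt_kernelAverage _ hh n x y t).congr_of_eventuallyEq ?_
  filter_upwards [lt_mem_nhds ht] with s hs
  exact gHat_eq_kernelAverage k hh n x y hs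

lemma ConditionK1.gHatSub_nonneg {k : ℝ → ℝ} (hK : ConditionK1 k) {h : ℝ} (hh : 0 < h) (n : ℕ)
    (x y : ℕ → ℝ) (i : Fin 2) {t : ℝ} (ht : h < t) : 0 ≤ gHatSub k h n x y i t := by
  rw [gHatSub_eq_kernelAverage k hh n x y i ht, kernelAverage]
  refine mul_nonneg hh.le (mul_nonneg (by positivity) (Finset.sum_nonneg fun j _ => ?_))
  exact mul_nonneg (statusWeight_nonneg _ _) (mul_nonneg (by positivity) (hK.nonneg _))

lemma ConditionK1.measurable_gHatSub {k : ℝ → ℝ} (hK : ConditionK1 k) (h : ℝ) (n : ℕ)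
    (x y : ℕ → ℝ) (i : Fin 2) : Measurable (gHatSub k h n x y i) := by
  have e : gHatSub k h n x y i = fun t => (1 / (n : ℝ)) * ∑ j ∈ Finset.range n,
      statusWeight i (x j, y j) * ((1 / h) * kernelAt k h t ((t - y j) / h)) :=
    funext fun t => gHatSub_eq_sum k h n x y i t
  rw [e]
  refine Measurable.const_mul (Finset.measurable_fun_sum _ fun j _ => ?_) _
  exact ((hK.measurable_kernelAt h (y j)).const_mul _).const_mul _

/-- On the nonnegative half-line the estimator is bounded by the relative number of inspection times
up to `t + h`. -/
lemma ConditionK1.abs_gHatSub_le {k : ℝ → ℝ} (hK : ConditionK1 k) {C h : ℝ}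
    (hC : ∀ h > 0, ∀ t ≥ 0, ∀ v, |kernelAt k h t v| ≤ C) (hh : 0 < h) (n : ℕ) (x y : ℕ → ℝ)
    (i : Fin 2) {t r : ℝ} (ht : 0 ≤ t) (hr : t + h ≤ r) :
    |gHatSub k h n x y i t| ≤
      C / h * ((1 / (n : ℝ)) *
        ∑ j ∈ Finset.range n, (Iic r).indicator (fun _ => (1 : ℝ)) (y j)) := by
  rw [gHatSub_eq_sum, abs_mul, abs_of_nonneg (by positivity : (0 : ℝ) ≤ 1 / n), mul_left_comm]
  refine mul_le_mul_of_nonneg_left ?_ (by positivity)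
  rw [Finset.mul_sum]
  refine (Finset.abs_sum_le_sum_abs _ _).trans (Finset.sum_le_sum fun j _ => ?_)
  by_cases hy : y j ∈ Iic r
  · rw [indicator_of_mem hy, abs_mul, abs_mul, abs_of_pos (by positivity : 0 < 1 / h)]
    calc _ ≤ 1 * (1 / h * C) := by
          refine mul_le_mul (abs_statusWeight_le _ _) ?_ (by positivity) one_pos.le
          gcongr
          exact hC h hh t ht _
      _ = _ := by ring
  · rw [indicator_of_notMem hy, hK.kernelAt_eq_zero hh (hr.trans_lt (not_le.1 hy))]
    simp

lemma ConditionK1.intervalIntegrable_gHatSub {k : ℝ → ℝ} (hK : ConditionK1 k) {h : ℝ} (hh : 0 < h)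
    (n : ℕ) (x y : ℕ → ℝ) (i : Fin 2) {s t : ℝ} (hs : 0 ≤ s) (ht : 0 ≤ t) :
    IntervalIntegrable (gHatSub k h n x y i) volume s t := by
  obtain ⟨C, hCpos, hC⟩ := hK.exists_bound_kernelAt
  have hb : ∀ u ≥ 0, |gHatSub k h n x y i u| ≤
      (1 / (n : ℝ)) * ∑ j ∈ Finset.range n, (1 * ((1 / h) * C)) := by
    intro u hu
    rw [gHatSub_eq_sum, abs_mul, abs_of_nonneg (by positivity : (0 : ℝ) ≤ 1 / n)]
    refine mul_le_mul_of_nonneg_left ?_ (by positivity)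
    refine (Finset.abs_sum_le_sum_abs _ _).trans (Finset.sum_le_sum fun j _ => ?_)
    rw [abs_mul, abs_mul, abs_of_pos (by positivity : 0 < 1 / h)]
    refine mul_le_mul (abs_statusWeight_le _ _) ?_ (by positivity) one_pos.le
    gcongr
    exact hC h hh u hu _
  rw [intervalIntegrable_iff]
  refine Measure.integrableOn_of_bounded measure_Ioc_lt_top.ne
    (hK.measurable_gHatSub h n x y i).aestronglyMeasurable
    ((ae_restrict_iff' measurableSet_uIoc).2 (ae_of_all _ fun u hu => hb u ?_))
  exact (le_min hs ht).trans hu.1.le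

lemma ConditionK1.bddAbove_support {k : ℝ → ℝ} (hK : ConditionK1 k) {h : ℝ} (hh : 0 < h) (n : ℕ)
    (x y : ℕ → ℝ) : BddAbove {t | 0 ≤ t ∧ 0 < gHat k h n x y t} := by
  obtain ⟨B, hB⟩ := ((Finset.range n).image y).bddAbove
  refine ⟨max h (B + h), fun t ⟨_, hpos⟩ => ?_⟩
  by_contra hcon
  rw [not_le, max_lt_iff] at hcon
  rw [gHat_eq_kernelAverage k hh n x y hcon.1, kernelAverage, Finset.sum_eq_zero, mul_zero,
    mul_zero] at hpos
  · exact lt_irrefl _ hpos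
  · intro j hj
    have hyj : y j ≤ B := hB (Finset.mem_coe.2 (Finset.mem_image_of_mem y hj))
    have : 1 < |(t - y j) / h| := by
      refine lt_of_lt_of_le ?_ (le_abs_self _)
      rw [lt_div_iff₀ hh]
      linarith [hcon.2]
    rw [hK.eq_zero this]
    simp

/-- If the tangent with slope `naive` at the parameter `t` supports the cumulative sum diagram, the
maximum smoothed likelihood estimator coincides with the naive estimator at `t`. -/
lemma ConditionK1.msle_eq_naive {k : ℝ → ℝ} (hK : ConditionK1 k) {h : ℝ} (hh : 0 < h) (n : ℕ)
    (x y : ℕ → ℝ) {t : ℝ} (ht : h < t) (hpos : 0 < gHat k h n x y t)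
    (hsup : ∀ s ≥ 0, 0 ≤ ∫ u in t..s,
      (gHatSub k h n x y 1 u - naive k h n x y t * gHat k h n x y u)) :
    msle k h n x y t = naive k h n x y t := by
  have ht0 : 0 < t := hh.trans ht
  set a := gHatSub k h n x y 1 with ha
  set b := gHat k h n x y with hb
  have ha' := (hK.hasDerivAt_gHatSub hh n x y 1 ht).continuousAt
  have hb' := (hK.hasDerivAt_gHat hh n x y ht).continuousAt
  have hai : ∀ {s t}, 0 ≤ s → 0 ≤ t → IntervalIntegrable a volume s t := fun hs ht =>
    hK.intervalIntegrable_gHatSub hh n x y 1 hs ht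
  have hbi : ∀ {s t}, 0 ≤ s → 0 ≤ t → IntervalIntegrable b volume s t := fun hs ht =>
    (hK.intervalIntegrable_gHatSub hh n x y 0 hs ht).add
      (hK.intervalIntegrable_gHatSub hh n x y 1 hs ht)
  have ham : Measurable a := hK.measurable_gHatSub h n x y 1
  have hbm : Measurable b := (hK.measurable_gHatSub h n x y 0).add ham
  have hτ : t < tau k h n x y := by
    obtain ⟨s, hs1, hs2⟩ := (((hb'.eventually (lt_mem_nhds hpos)).filter_mono
      nhdsWithin_le_nhds).and (self_mem_nhdsWithin : Ioi t ∈ 𝓝[>] t)).exists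
    exact lt_of_lt_of_le hs2 (le_csSup (hK.bddAbove_support hh n x y)
      ⟨(ht0.trans hs2).le, hs1⟩)
  refine hullSlope_eq_of_support (A := fun t => GHatSub k h n x y 1 t)
    (B := fun t => GHat k h n x y t) (a := a t) (b := b t) ht0.le hτ ?_ ?_ ?_ hpos ?_
  · exact intervalIntegral.integral_hasDerivAt_right (hai le_rfl ht0.le)
      ham.stronglyMeasurable.stronglyMeasurableAtFilter ha'
  · exact intervalIntegral.integral_hasDerivAt_right (hbi le_rfl ht0.le)
      hbm.stronglyMeasurable.stronglyMeasurableAtFilter hb'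
  · have hτ0 : 0 ≤ tau k h n x y := ht0.le.trans hτ.le
    have := intervalIntegral.continuousOn_primitive_interval'
      (hbi le_rfl hτ0) (a := 0) left_mem_uIcc
    rwa [uIcc_of_le hτ0] at this
  · intro s hs
    have h1 := hsup s hs.1
    rw [intervalIntegral.integral_sub (hai ht0.le hs.1) ((hbi ht0.le hs.1).const_mul _),
      intervalIntegral.integral_const_mul,
      ← intervalIntegral.integral_interval_sub_left (hai le_rfl hs.1) (hai le_rfl ht0.le),
      ← intervalIntegral.integral_interval_sub_left (hbi le_rfl hs.1) (hbi le_rfl ht0.le)] at h1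
    simp only [GHatSub, GHat]
    exact sub_nonneg.1 h1

/-! ### From monotonicity of the naive estimator to the supporting line -/

lemma mul_sub_le_of_hasDerivAt {f f' : ℝ → ℝ} {C s t : ℝ} (hst : s ≤ t)
    (hf : ∀ u ∈ Icc s t, HasDerivAt f (f' u) u) (hC : ∀ u ∈ Icc s t, C ≤ f' u) :
    C * (t - s) ≤ f t - f s := by
  refine (convex_Icc s t).mul_sub_le_image_sub_of_le_deriv
    (fun u hu => (hf u hu).continuousAt.continuousWithinAt)
    (fun u hu => (hf u (interior_subset hu)).differentiableAt.differentiableWithinAt)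
    (fun u hu => ?_) s (left_mem_Icc.2 hst) t (right_mem_Icc.2 hst) hst
  rw [(hf u (interior_subset hu)).deriv]
  exact hC u (interior_subset hu)

/-- The function `q` need not be increasing on the last stretch `[p, p + ℓ]`, where only `q' ≥ -c`
is known; the increase at rate `c` on a stretch of the same length `ℓ` before `p` makes up for it. -/
lemma le_of_deriv_bounds {q q' : ℝ → ℝ} {l p c ℓ : ℝ} (hc : 0 ≤ c) (hℓ : 0 ≤ ℓ)
    (hq : ∀ u ∈ Ioc l (p + ℓ), HasDerivAt q (q' u) u) (h1 : ∀ u ∈ Ioc l p, c ≤ q' u)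
    (h2 : ∀ u ∈ Icc p (p + ℓ), -c ≤ q' u) {t u : ℝ} (ht : t ∈ Ioc l (p - ℓ))
    (hu : u ∈ Icc t (p + ℓ)) : q t ≤ q u := by
  have hinc : ∀ u ∈ Icc t p, c * (u - t) ≤ q u - q t := fun u hu =>
    mul_sub_le_of_hasDerivAt hu.1
      (fun v hv => hq v ⟨ht.1.trans_le hv.1, by linarith [hv.2, hu.2]⟩)
      fun v hv => h1 v ⟨ht.1.trans_le hv.1, hv.2.trans hu.2⟩
  rcases le_total u p with hup | hup
  · have := hinc u ⟨hu.1, hup⟩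
    have : 0 ≤ c * (u - t) := mul_nonneg hc (by linarith [hu.1])
    linarith
  · have k1 := hinc p ⟨by linarith [ht.2], le_rfl⟩
    have k2 : -c * (u - p) ≤ q u - q p := mul_sub_le_of_hasDerivAt hup
      (fun v hv => hq v ⟨by linarith [ht.1, ht.2, hv.1], hv.2.trans hu.2⟩)
      fun v hv => h2 v ⟨hv.1, hv.2.trans hu.2⟩
    have k3 : 0 ≤ c * ((p - t) - (u - p)) := mul_nonneg hc (by linarith [hu.2, ht.2])
    linarith

/-- The line of slope `a t / b t` supports the cumulative sum diagram at `t`. On `(h, ∞)` this comes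
from the comparison of the ratios `a / b`; the boundary region `[0, h]`, where `a` and `b` may be
negative, contributes little (`κ`), and is outweighed by the strict increase of `a / b` on
`(h, M₀]`. -/
lemma integral_sub_mul_nonneg {a b : ℝ → ℝ} {h m M₀ M₁ c₁ c₂ κ t : ℝ} (hh : 0 < h) (hm : h < m)
    (hmM : m ≤ M₀) (hM : M₀ ≤ M₁) (hc₁ : 0 ≤ c₁)
    (ha : ∀ s t, 0 ≤ s → 0 ≤ t → IntervalIntegrable a volume s t)
    (hb : ∀ s t, 0 ≤ s → 0 ≤ t → IntervalIntegrable b volume s t)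
    (ha0 : ∀ u > h, 0 ≤ a u) (hab : ∀ u > h, a u ≤ b u) (hbpos : ∀ u ∈ Ioc h M₁, 0 < b u)
    (hmono : ∀ t ∈ Ioc h M₀, ∀ u ∈ Icc t M₁, a t / b t ≤ a u / b u)
    (hsteep : ∀ u ∈ Ioc h M₀, ∀ t ∈ Icc u M₀, c₁ * (t - u) ≤ a t / b t - a u / b u)
    (hc₂ : 0 ≤ c₂) (hbc : ∀ u ∈ Ioc h M₀, c₂ ≤ b u) (htail : ∀ u > M₁, a u = b u)
    (hbdry : ∀ u ∈ Icc 0 h, |a u| + |b u| ≤ κ / h) (hκ : κ ≤ c₁ * c₂ * (m - h) ^ 2 / 2)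
    (ht : t ∈ Icc m M₀ ∨ M₁ < t) (hbt : 0 < b t) {s : ℝ} (hs : 0 ≤ s) :
    0 ≤ ∫ u in t..s, (a u - a t / b t * b u) := by
  have hmt : m ≤ t := ht.elim (fun ht => ht.1) fun ht => by linarith
  have hht : h < t := hm.trans_le hmt
  set r := a t / b t with hr
  have hr0 : 0 ≤ r := div_nonneg (ha0 t hht) hbt.le
  have hr1 : r ≤ 1 := (div_le_one hbt).2 (hab t hht)
  have hrtail : M₁ < t → r = 1 := fun h1 => by rw [hr, htail t h1, div_self hbt.ne']
  set f : ℝ → ℝ := fun u => a u - r * b u with hf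
  have hfi : ∀ s t, 0 ≤ s → 0 ≤ t → IntervalIntegrable f volume s t := fun s t hs ht =>
    (ha s t hs ht).sub ((hb s t hs ht).const_mul r)
  have hq : ∀ u ∈ Ioc h M₁, f u = (a u / b u - r) * b u := fun u hu => by
    rw [sub_mul, div_mul_cancel₀ _ (hbpos u hu).ne']
  have hright : ∀ u > t, 0 ≤ f u := by
    intro u hu
    rcases le_or_gt u M₁ with h1 | h1
    · rcases ht with ht | ht
      · rw [hq u ⟨hht.trans hu, h1⟩]
        exact mul_nonneg (sub_nonneg.2 (hmono t ⟨hht, ht.2⟩ u ⟨hu.le, h1⟩))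
          (hbpos u ⟨hht.trans hu, h1⟩).le
      · linarith
    · simp only [hf, htail u h1]
      have := (ha0 u (hht.trans hu)).trans (hab u (hht.trans hu))
      nlinarith
  have hleft : ∀ u ∈ Ioc h t, f u ≤ 0 := by
    intro u hu
    rcases ht with ht | ht
    · have hu1 : u ∈ Ioc h M₁ := ⟨hu.1, hu.2.trans (ht.2.trans hM)⟩
      rw [hq u hu1]
      exact mul_nonpos_of_nonpos_of_nonneg
        (sub_nonpos.2 (hmono u ⟨hu.1, hu.2.trans ht.2⟩ t ⟨hu.2, ht.2.trans hM⟩))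
        (hbpos u hu1).le
    · simp only [hf, hrtail ht, one_mul]
      exact sub_nonpos.2 (hab u hu.1)
  rcases le_total t s with hts | hst
  · refine intervalIntegral.integral_nonneg_of_ae_restrict hts ?_
    rw [← restrict_Ioc_eq_restrict_Icc]
    exact (ae_restrict_iff' measurableSet_Ioc).2 (ae_of_all _ fun u hu => hright u hu.1)
  rw [intervalIntegral.integral_symm, neg_nonneg]
  have hnonpos : ∀ s t', h ≤ s → s ≤ t' → t' ≤ t → ∫ u in s..t', f u ≤ 0 := by
    intro s t' h1 h2 h3
    rw [← neg_nonneg, ← intervalIntegral.integral_neg]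
    refine intervalIntegral.integral_nonneg_of_ae_restrict h2 ?_
    rw [← restrict_Ioc_eq_restrict_Icc]
    exact (ae_restrict_iff' measurableSet_Ioc).2
      (ae_of_all _ fun u hu => neg_nonneg.2 (hleft u ⟨h1.trans_lt hu.1, hu.2.trans h3⟩))
  rcases le_total h s with hhs | hsh
  · exact hnonpos s t hhs hst le_rfl
  set t₀ := min t M₀ with ht₀
  have hmt₀ : m ≤ t₀ := le_min hmt hmM
  have ht₀t : t₀ ≤ t := min_le_left _ _
  have hrt₀ : a t₀ / b t₀ ≤ r := by
    rcases ht with ht | ht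
    · rw [ht₀, min_eq_left ht.2]
    · rw [hrtail ht]
      have h1 : t₀ ∈ Ioc h M₁ := ⟨hm.trans_le hmt₀, (min_le_right _ _).trans hM⟩
      exact (div_le_one (hbpos _ h1)).2 (hab _ h1.1)
  have hpart1 : ∫ u in s..h, f u ≤ κ := by
    have hbound : ∀ u ∈ uIoc s h, ‖f u‖ ≤ κ / h := by
      intro u hu
      rw [uIoc_of_le hsh] at hu
      refine le_trans ?_ (hbdry u ⟨hs.trans hu.1.le, hu.2⟩)
      rw [Real.norm_eq_abs]
      calc |a u - r * b u| ≤ |a u| + |r * b u| := abs_sub _ _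
        _ ≤ |a u| + 1 * |b u| := by rw [abs_mul, abs_of_nonneg hr0]; gcongr
        _ = _ := by rw [one_mul]
    have hκ0 : 0 ≤ κ / h :=
      (add_nonneg (abs_nonneg _) (abs_nonneg _)).trans (hbdry 0 ⟨le_rfl, hh.le⟩)
    calc ∫ u in s..h, f u ≤ ‖∫ u in s..h, f u‖ := le_abs_self _
      _ ≤ κ / h * |h - s| := intervalIntegral.norm_integral_le_of_norm_le_const hbound
      _ ≤ κ / h * h := by
          gcongr
          rw [abs_of_nonneg (by linarith)]
          linarith
      _ = κ := div_mul_cancel₀ _ hh.ne'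
  have hpart2 : ∫ u in h..t₀, f u ≤ -(c₁ * c₂ * (m - h) ^ 2 / 2) := by
    have hht₀ : h ≤ t₀ := (hm.trans_le hmt₀).le
    have hle : ∫ u in h..t₀, f u ≤ ∫ u in h..t₀, -(c₁ * c₂) * (t₀ - u) := by
      refine intervalIntegral.integral_mono_ae_restrict hht₀
        (hfi _ _ hh.le (hh.le.trans hht₀)) (Continuous.intervalIntegrable (by fun_prop) _ _) ?_
      rw [← restrict_Ioc_eq_restrict_Icc]
      refine (ae_restrict_iff' measurableSet_Ioc).2 (ae_of_all _ fun u hu => ?_)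
      have hu0 : u ∈ Ioc h M₀ := ⟨hu.1, hu.2.trans (min_le_right _ _)⟩
      have h1 := hsteep u hu0 t₀ ⟨hu.2, min_le_right _ _⟩
      have hd : 0 ≤ c₁ * (t₀ - u) := mul_nonneg hc₁ (sub_nonneg.2 hu.2)
      simp only
      rw [hq u ⟨hu.1, hu0.2.trans hM⟩]
      have h2 : c₁ * (t₀ - u) ≤ r - a u / b u := by linarith
      have h3 := mul_le_mul h2 (hbc u hu0) hc₂ (hd.trans h2)
      linarith
    have hint : ∫ u in h..t₀, -(c₁ * c₂) * (t₀ - u) = -(c₁ * c₂ * (t₀ - h) ^ 2 / 2) := by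
      rw [intervalIntegral.integral_const_mul, intervalIntegral.integral_comp_sub_left (fun u => u),
        integral_id]
      ring
    rw [hint] at hle
    refine hle.trans (neg_le_neg ?_)
    have : 0 ≤ m - h := by linarith
    gcongr
  have hpart3 := hnonpos t₀ t ((hm.trans_le hmt₀).le) ht₀t le_rfl
  have ht₀0 : 0 ≤ t₀ := hh.le.trans (hm.trans_le hmt₀).le
  have hsplit : ∫ u in s..t, f u =
      (∫ u in s..h, f u) + (∫ u in h..t₀, f u) + ∫ u in t₀..t, f u := by
    rw [intervalIntegral.integral_add_adjacent_intervals (hfi _ _ hs hh.le) (hfi _ _ hh.le ht₀0),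
      intervalIntegral.integral_add_adjacent_intervals (hfi _ _ hs ht₀0)
        (hfi _ _ ht₀0 (ht₀0.trans ht₀t))]
  rw [hsplit]
  linarith

/-- A sample for which the naive estimator and the maximum smoothed likelihood estimator coincide.
The conditions are those of `integral_sub_mul_nonneg`, with the comparison of the ratios expressed
through `a' b - a b'`, the numerator of the derivative of `a / b`. -/
lemma ConditionK1.msle_eq_naive_of_bounds {k : ℝ → ℝ} (hK : ConditionK1 k) {h m M₀ c₂ C D κ t : ℝ}
    (hh : 0 < h) (hm : h < m) (hmM : m ≤ M₀) (n : ℕ) (x y : ℕ → ℝ) (hc₂ : 0 < c₂) (hD : 0 ≤ D)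
    (hb : ∀ u ∈ Ioc h (M₀ + h), gHat k h n x y u ∈ Icc c₂ C)
    (hnum : ∀ u ∈ Ioc h (M₀ + h / 2), D ≤
      kernelAverage (deriv k) (statusWeight 1) h n x y u * gHat k h n x y u -
        gHatSub k h n x y 1 u * kernelAverage (deriv k) (fun _ => 1) h n x y u)
    (hnum' : ∀ u ∈ Icc (M₀ + h / 2) (M₀ + h), -(D * c₂ ^ 2 / C ^ 2) ≤
      kernelAverage (deriv k) (statusWeight 1) h n x y u * gHat k h n x y u -
        gHatSub k h n x y 1 u * kernelAverage (deriv k) (fun _ => 1) h n x y u)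
    (htail : ∀ u > M₀ + h, gHatSub k h n x y 0 u = 0)
    (hbdry : ∀ u ∈ Icc 0 h, |gHatSub k h n x y 1 u| + |gHat k h n x y u| ≤ κ / h)
    (hκ : κ ≤ D / C ^ 2 * c₂ * (m - h) ^ 2 / 2)
    (ht : t ∈ Icc m M₀ ∨ M₀ + h < t) (hbt : 0 < gHat k h n x y t) :
    msle k h n x y t = naive k h n x y t := by
  have hht : h < t := ht.elim (fun ht => hm.trans_le ht.1) fun ht => by linarith
  refine hK.msle_eq_naive hh n x y hht hbt fun s hs => ?_
  set a := gHatSub k h n x y 1 with ha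
  set b := gHat k h n x y with hbdef
  set a' := kernelAverage (deriv k) (statusWeight 1) h n x y
  set b' := kernelAverage (deriv k) (fun _ => 1) h n x y
  have hC : 0 < C := by
    have := hb m ⟨hm, by linarith⟩
    exact hc₂.trans_le (this.1.trans this.2)
  have hbpos : ∀ u ∈ Ioc h (M₀ + h), 0 < b u := fun u hu => hc₂.trans_le (hb u hu).1
  set c₁ := D / C ^ 2 with hc₁def
  have hc₁ : 0 ≤ c₁ := by positivity
  set q' : ℝ → ℝ := fun u => (a' u * b u - a u * b' u) / b u ^ 2 with hq'
  have hq : ∀ u ∈ Ioc h (M₀ + h), HasDerivAt (fun u => a u / b u) (q' u) u := fun u hu =>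
    (hK.hasDerivAt_gHatSub hh n x y 1 hu.1).div (hK.hasDerivAt_gHat hh n x y hu.1)
      (hbpos u hu).ne'
  have hq1 : ∀ u ∈ Ioc h (M₀ + h / 2), c₁ ≤ q' u := by
    intro u hu
    have hu' : u ∈ Ioc h (M₀ + h) := ⟨hu.1, hu.2.trans (by linarith)⟩
    have hbu := hbpos u hu'
    rw [hq', hc₁def, div_le_div_iff₀ (by positivity) (by positivity)]
    have h1 : b u ^ 2 ≤ C ^ 2 := pow_le_pow_left₀ hbu.le (hb u hu').2 2
    exact mul_le_mul (hnum u hu) h1 (by positivity) (hD.trans (hnum u hu))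
  have hq2 : ∀ u ∈ Icc (M₀ + h / 2) (M₀ + h), -c₁ ≤ q' u := by
    intro u hu
    have hu' : u ∈ Ioc h (M₀ + h) := ⟨by linarith [hu.1], hu.2⟩
    have hbu := hbpos u hu'
    rw [hq', le_div_iff₀ (by positivity)]
    refine le_trans ?_ (hnum' u hu)
    have h1 : c₂ ^ 2 ≤ b u ^ 2 := pow_le_pow_left₀ hc₂.le (hb u hu').1 2
    rw [neg_mul, neg_le_neg_iff, hc₁def, mul_div_right_comm]
    gcongr
  have hsplit : M₀ + h / 2 + h / 2 = M₀ + h := by ring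
  refine integral_sub_mul_nonneg (M₁ := M₀ + h) (c₁ := c₁) (c₂ := c₂) (κ := κ) hh hm hmM
    (by linarith) hc₁ (fun s t hs ht => hK.intervalIntegrable_gHatSub hh n x y 1 hs ht)
    (fun s t hs ht => (hK.intervalIntegrable_gHatSub hh n x y 0 hs ht).add
      (hK.intervalIntegrable_gHatSub hh n x y 1 hs ht))
    (fun u hu => hK.gHatSub_nonneg hh n x y 1 hu)
    (fun u hu => le_add_of_nonneg_left (hK.gHatSub_nonneg hh n x y 0 hu)) hbpos
    (fun t ht u hu => ?_) (fun u hu t ht => ?_) hc₂.le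
    (fun u hu => (hb u ⟨hu.1, by linarith [hu.2]⟩).1)
    (fun u hu => by rw [htail u hu, zero_add]) hbdry hκ ht hbt hs
  · exact le_of_deriv_bounds (q := fun u => a u / b u) (ℓ := h / 2) (p := M₀ + h / 2) (l := h) hc₁
      (by positivity) (by rwa [hsplit]) hq1 (by rwa [hsplit])
      ⟨ht.1, by linarith [ht.2]⟩ ⟨hu.1, by linarith [hu.2]⟩
  · exact mul_sub_le_of_hasDerivAt (f := fun u => a u / b u) ht.1
      (fun v hv => hq v ⟨hu.1.trans_le hv.1, by linarith [hv.2, ht.2]⟩)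
      fun v hv => hq1 v ⟨hu.1.trans_le hv.1, by linarith [hv.2, ht.2]⟩

/-! ### Population quantities -/

lemma IsDensity.integral_eq {Q : Measure ℝ} {f : ℝ → ℝ} (hf : IsDensity Q f) (ψ : ℝ → ℝ) :
    ∫ u, ψ u ∂Q = ∫ u, ψ u * f u := by
  rw [hf.eq_withDensity, integral_withDensity_eq_integral_toReal_smul
    hf.measurable.ennreal_ofReal (ae_of_all _ fun _ => ENNReal.ofReal_lt_top)]
  refine integral_congr_ae (ae_of_all _ fun u => ?_)
  simp only [ENNReal.toReal_ofReal (hf.nonneg u), smul_eq_mul, mul_comm]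

lemma IsDensity.integrable {Q : Measure ℝ} [IsProbabilityMeasure Q] {f : ℝ → ℝ}
    (hf : IsDensity Q f) : Integrable f := by
  refine ⟨hf.measurable.aestronglyMeasurable, ?_⟩
  rw [hasFiniteIntegral_iff_ofReal (ae_of_all _ hf.nonneg)]
  have h1 : Q univ = ∫⁻ u, ENNReal.ofReal (f u) := by
    rw [hf.eq_withDensity, withDensity_apply _ MeasurableSet.univ, setLIntegral_univ]
  rw [← h1]
  exact measure_lt_top _ _

lemma IsDensity.integrable_mul {Q : Measure ℝ} [IsProbabilityMeasure Q] {f : ℝ → ℝ}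
    (hf : IsDensity Q f) {ψ : ℝ → ℝ} (hψ : Measurable ψ) {B : ℝ} (hB : ∀ u, |ψ u| ≤ B) :
    Integrable fun u => ψ u * f u :=
  hf.integrable.bdd_mul hψ.aestronglyMeasurable (ae_of_all _ hB)

lemma IsDensity.absolutelyContinuous {Q : Measure ℝ} {f : ℝ → ℝ} (hf : IsDensity Q f) :
    Q ≪ volume := by
  rw [hf.eq_withDensity]
  exact withDensity_absolutelyContinuous _ _

/-- Short intervals have uniformly small probability. -/
lemma IsDensity.exists_real_Icc_le {Q : Measure ℝ} [IsProbabilityMeasure Q] {f : ℝ → ℝ}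
    (hf : IsDensity Q f) {η : ℝ} (hη : 0 < η) :
    ∃ δ > 0, ∀ a b, b - a < δ → Q.real (Icc a b) ≤ η := by
  have hfin : ∫⁻ u, ENNReal.ofReal (f u) ≠ ⊤ := by
    have := hf.integrable.2
    rw [hasFiniteIntegral_iff_ofReal (ae_of_all _ hf.nonneg)] at this
    exact this.ne
  obtain ⟨δ, hδ, h⟩ := exists_pos_setLIntegral_lt_of_measure_lt hfin
    (ENNReal.ofReal_pos.2 hη).ne'
  obtain ⟨δ', hδ', hlt⟩ : ∃ δ' : ℝ, 0 < δ' ∧ ENNReal.ofReal δ' ≤ δ := by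
    obtain ⟨r, hr0, hr⟩ := ENNReal.lt_iff_exists_nnreal_btwn.1 hδ
    exact ⟨r, by exact_mod_cast hr0, by rw [ENNReal.ofReal_coe_nnreal]; exact hr.le⟩
  refine ⟨δ', hδ', fun a b hab => ?_⟩
  have h1 : volume (Icc a b) < δ := by
    rw [Real.volume_Icc]
    exact ((ENNReal.ofReal_lt_ofReal_iff hδ').2 hab).trans_le hlt
  have h2 := (h _ h1).le
  rw [← withDensity_apply _ measurableSet_Icc, ← hf.eq_withDensity] at h2
  exact ENNReal.toReal_le_of_le_ofReal hη.le h2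

lemma ConditionF1.pos {PX : Measure ℝ} [IsProbabilityMeasure PX] {f₀ : ℝ → ℝ} {M₀ : ℝ}
    (hF : ConditionF1 PX f₀ M₀) : 0 < M₀ := by
  by_contra hM
  have h1 : PX (Icc 0 M₀)ᶜ = 0 := by
    rw [← hF.support_eq]
    exact Measure.measure_compl_support
  have h2 : PX (Icc 0 M₀) = 0 := by
    refine hF.density.absolutelyContinuous ?_
    rw [Real.volume_Icc, ENNReal.ofReal_eq_zero]
    linarith
  have h3 : PX univ ≤ PX (Icc 0 M₀) + PX (Icc 0 M₀)ᶜ := by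
    rw [← union_compl_self (Icc 0 M₀)]
    exact measure_union_le _ _
  rw [h1, h2, measure_univ] at h3
  norm_num at h3

/-- Consequences of (G.1): on a right neighbourhood of `[0, M₀]` the density `g` is bounded, bounded
away from zero, and satisfies a Lipschitz estimate relative to the points of `[0, M₀]`. Beyond `M₀`
this rests on the differentiability of `g` at `M₀`. -/
lemma ConditionG1.exists_bounds {PT : Measure ℝ} {g : ℝ → ℝ} {M₀ : ℝ} (hG : ConditionG1 PT g M₀)
    (hM₀ : 0 < M₀) : ∃ δ > 0, ∃ ε > 0, ∃ C > 0,
      (∀ u ∈ Icc 0 (M₀ + δ), ε ≤ g u ∧ g u ≤ C) ∧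
        ∀ u ∈ Icc 0 (M₀ + δ), ∀ v ∈ Icc 0 M₀, |g u - g v| ≤ C * |u - v| := by
  obtain ⟨ε, hε, hlow⟩ := hG.away_from_zero
  obtain ⟨B, hB⟩ := hG.bounded_deriv
  have hmem : M₀ ∈ Icc 0 M₀ := right_mem_Icc.2 hM₀.le
  have hB0 : 0 ≤ B := (abs_nonneg _).trans (hB _ hmem)
  have hlip : ∀ u ∈ Icc 0 M₀, ∀ v ∈ Icc 0 M₀, |g u - g v| ≤ B * |u - v| := fun u hu v hv =>
    (convex_Icc (0 : ℝ) M₀).norm_image_sub_le_of_norm_hasDerivWithin_le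
      (f' := derivWithin g (Ici 0))
      (fun x hx => (hG.differentiable x hx).hasDerivWithinAt.mono Icc_subset_Ici_self) hB hv hu
  have hd : HasDerivAt g (derivWithin g (Ici 0) M₀) M₀ :=
    (hG.differentiable _ hmem).hasDerivWithinAt.hasDerivAt (Ici_mem_nhds hM₀)
  obtain ⟨δ₁, hδ₁, h1⟩ := Metric.eventually_nhds_iff.1
    ((hasDerivAt_iff_isLittleO.1 hd).def one_pos)
  have hright : ∀ u ∈ Ico M₀ (M₀ + δ₁), |g u - g M₀| ≤ (B + 1) * (u - M₀) := by
    intro u hu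
    have k := h1 (y := u) (by
      rw [Real.dist_eq, abs_of_nonneg (by linarith [hu.1])]; linarith [hu.2])
    rw [Real.norm_eq_abs, Real.norm_eq_abs, one_mul, smul_eq_mul,
      abs_of_nonneg (sub_nonneg.2 hu.1)] at k
    have hu0 : 0 ≤ u - M₀ := sub_nonneg.2 hu.1
    have k2 : |(u - M₀) * derivWithin g (Ici 0) M₀| ≤ (u - M₀) * B := by
      rw [abs_mul, abs_of_nonneg hu0]
      exact mul_le_mul_of_nonneg_left (hB _ hmem) hu0
    have k3 := abs_add_le (g u - g M₀ - (u - M₀) * derivWithin g (Ici 0) M₀)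
      ((u - M₀) * derivWithin g (Ici 0) M₀)
    rw [sub_add_cancel] at k3
    linarith
  set δ := min (δ₁ / 2) (ε / (2 * (B + 1))) with hδdef
  have hδ : 0 < δ := by positivity
  have hδle : (B + 1) * δ ≤ ε / 2 := by
    have : δ ≤ ε / (2 * (B + 1)) := min_le_right _ _
    rw [le_div_iff₀ (by positivity)] at this
    linarith
  have hδ1 : δ < δ₁ := (min_le_left _ _).trans_lt (half_lt_self hδ₁)
  have hall : ∀ u ∈ Icc 0 (M₀ + δ), ∀ v ∈ Icc 0 M₀, |g u - g v| ≤ (B + 1) * |u - v| := by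
    intro u hu v hv
    rcases le_total u M₀ with huM | huM
    · refine (hlip u ⟨hu.1, huM⟩ v hv).trans ?_
      gcongr
      linarith
    · have k1 := hright u ⟨huM, by linarith [hu.2]⟩
      have k2 := hlip M₀ hmem v hv
      have k3 := abs_sub_le (g u) (g M₀) (g v)
      rw [abs_of_nonneg (sub_nonneg.2 hv.2)] at k2
      rw [abs_of_nonneg (sub_nonneg.2 (hv.2.trans huM))]
      nlinarith [hv.2]
  have hnear : ∀ u ∈ Icc M₀ (M₀ + δ), |g u - g M₀| ≤ ε / 2 := fun u hu => by
    refine (hright u ⟨hu.1, by linarith [hu.2]⟩).trans (le_trans ?_ hδle)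
    have : 0 ≤ B + 1 := by linarith
    gcongr
    linarith [hu.2]
  refine ⟨δ, hδ, ε / 2, half_pos hε, max (B + 1) (g M₀ + (B + 1) * (M₀ + δ)),
    lt_max_of_lt_left (by linarith), fun u hu => ⟨?_, ?_⟩, fun u hu v hv => ?_⟩
  · rcases le_total u M₀ with huM | huM
    · linarith [hlow u ⟨hu.1, huM⟩]
    · linarith [(abs_le.1 (hnear u ⟨huM, hu.2⟩)).1, hlow _ hmem]
  · refine le_trans ?_ (le_max_right _ _)
    have k1 := (abs_le.1 (hall u hu M₀ hmem)).2
    have k2 : |u - M₀| ≤ M₀ + δ := by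
      rw [abs_le]
      constructor <;> linarith [hu.1, hu.2]
    have : (B + 1) * |u - M₀| ≤ (B + 1) * (M₀ + δ) := by gcongr
    linarith
  · refine (hall u hu v hv).trans ?_
    gcongr
    exact le_max_left _ _

/-- Inspection times are nonnegative and their density is bounded near `[0, M₀]`. -/
lemma ConditionG1.real_Icc_le {PT : Measure ℝ} [IsProbabilityMeasure PT] {g : ℝ → ℝ} {M₀ C M : ℝ}
    (hG : ConditionG1 PT g M₀) (hC : 0 ≤ C) (hg : ∀ u ∈ Icc 0 M, g u ≤ C) {a b : ℝ} (hab : a ≤ b)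
    (hb : b ≤ M) : PT.real (Icc a b) ≤ C * (b - a) := by
  have hneg : PT (Ici 0)ᶜ = 0 := by
    rw [← hG.support_eq]
    exact Measure.measure_compl_support
  refine ENNReal.toReal_le_of_le_ofReal (mul_nonneg hC (sub_nonneg.2 hab)) ?_
  calc PT (Icc a b) ≤ PT (Icc (max a 0) b) + PT (Ici 0)ᶜ := by
        refine (measure_mono fun u hu => ?_).trans (measure_union_le _ _)
        by_cases hu0 : 0 ≤ u
        · exact Or.inl ⟨max_le hu.1 hu0, hu.2⟩
        · exact Or.inr hu0
    _ = ∫⁻ u in Icc (max a 0) b, ENNReal.ofReal (g u) := by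
        rw [hneg, add_zero, hG.density.eq_withDensity, withDensity_apply _ measurableSet_Icc]
    _ ≤ ∫⁻ _u in Icc (max a 0) b, ENNReal.ofReal C := by
        refine setLIntegral_mono measurable_const fun u hu => ENNReal.ofReal_le_ofReal ?_
        exact hg u ⟨(le_max_right _ _).trans hu.1, hu.2.trans hb⟩
    _ = ENNReal.ofReal C * ENNReal.ofReal (b - max a 0) := by
        rw [setLIntegral_const, Real.volume_Icc]
    _ ≤ ENNReal.ofReal C * ENNReal.ofReal (b - a) := by
        gcongr
        exact le_max_left _ _
    _ = ENNReal.ofReal (C * (b - a)) := (ENNReal.ofReal_mul hC).symm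

lemma kernelMean_one {PX PT : Measure ℝ} [IsProbabilityMeasure PX] [IsProbabilityMeasure PT]
    {g φ : ℝ → ℝ} (hg : IsDensity PT g) (h t : ℝ) :
    kernelMean φ (fun _ => 1) PX PT h t = h⁻¹ ^ 2 * ∫ u, φ ((t - u) / h) * g u := by
  rw [kernelMean]
  simp only [one_mul]
  rw [integral_const_mul, integral_fun_snd (μ := PX) (f := fun u => φ ((t - u) / h)),
    hg.integral_eq]
  simp

/-- As `X` and `T` are independent, conditioning on `T` replaces the indicator of `X ≤ T` by
`F₀(T)`. -/
lemma kernelMean_statusWeight {PX PT : Measure ℝ} [IsProbabilityMeasure PX]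
    [IsProbabilityMeasure PT] {g φ : ℝ → ℝ} (hg : IsDensity PT g) (hφ : Measurable φ) {K : ℝ}
    (hK : ∀ u, |φ u| ≤ K) (h t : ℝ) :
    kernelMean φ (statusWeight 1) PX PT h t =
      h⁻¹ ^ 2 * ∫ u, (PX.real (Iic u) * φ ((t - u) / h)) * g u := by
  have hint : Integrable (fun z : ℝ × ℝ => statusWeight 1 z * (h⁻¹ ^ 2 * φ ((t - z.2) / h)))
      (PX.prod PT) :=
    Integrable.of_bound
      (measurable_kernel_term hφ (measurable_statusWeight 1) h t).aestronglyMeasurable _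
      (ae_of_all _ (abs_kernel_term_le hK (abs_statusWeight_le 1) h t))
  have hinner : ∀ y, ∫ x, statusWeight 1 (x, y) ∂PX = PX.real (Iic y) := by
    intro y
    have : (fun x => statusWeight 1 (x, y)) = (Iic y).indicator fun _ => (1 : ℝ) := by
      funext x
      by_cases hx : x ≤ y
      · simp [statusWeight, delta, hx]
      · simp [statusWeight, delta, hx]
    rw [this, integral_indicator_const _ measurableSet_Iic, smul_eq_mul, mul_one]
  rw [kernelMean, integral_prod_symm _ hint, ← integral_const_mul, hg.integral_eq]
  refine integral_congr_ae (ae_of_all _ fun y => ?_)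
  simp only
  rw [integral_mul_const, hinner]
  ring

section Window

variable {k : ℝ → ℝ} {h t : ℝ}

lemma eq_zero_of_notMem_window {φ : ℝ → ℝ} (hφ : ∀ u, 1 < |u| → φ u = 0) (hh : 0 < h) {u : ℝ}
    (hu : u ∉ Icc (t - h) (t + h)) : φ ((t - u) / h) = 0 := by
  refine hφ _ ?_
  by_contra hcon
  exact hu (mem_Icc_of_div_mem hh (not_lt.1 hcon))

lemma abs_integral_le_of_window {ψ : ℝ → ℝ} {B : ℝ} (hh : 0 < h)
    (h0 : ∀ u, u ∉ Icc (t - h) (t + h) → ψ u = 0) (hB : ∀ u ∈ Icc (t - h) (t + h), |ψ u| ≤ B) :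
    |∫ u, ψ u| ≤ B * (2 * h) := by
  rw [← setIntegral_eq_integral_of_forall_compl_eq_zero h0]
  have := norm_setIntegral_le_of_norm_le_const (μ := volume) (f := ψ)
    (s := Icc (t - h) (t + h)) (C := B) measure_Icc_lt_top hB
  rw [measureReal_def, Real.volume_Icc, ENNReal.toReal_ofReal (by linarith)] at this
  rwa [show t + h - (t - h) = 2 * h by ring, Real.norm_eq_abs] at this

lemma ConditionK1.hasDerivAt_comp (hK : ConditionK1 k) (hh : 0 < h) (t u : ℝ) :
    HasDerivAt (fun u => -h * k ((t - u) / h)) (deriv k ((t - u) / h)) u := by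
  have := ((hK.hasDerivAt ((t - u) / h)).comp u
    (((hasDerivAt_id u).const_sub t).div_const h)).const_mul (-h)
  refine this.congr_deriv ?_
  field_simp

lemma ConditionK1.integrable_comp (hK : ConditionK1 k) (hh : 0 < h) (t : ℝ) :
    Integrable (fun u => k ((t - u) / h)) ∧ Integrable fun u => deriv k ((t - u) / h) := by
  have key : ∀ φ : ℝ → ℝ, Continuous φ → (∀ u, 1 < |u| → φ u = 0) →
      Integrable fun u => φ ((t - u) / h) := by
    intro φ hφ h0
    refine Continuous.integrable_of_hasCompactSupport (by fun_prop) ?_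
    exact HasCompactSupport.intro isCompact_Icc fun u hu => eq_zero_of_notMem_window h0 hh hu
  exact ⟨key k hK.contDiff.continuous fun _ => hK.eq_zero,
    key _ hK.contDiff_deriv.continuous fun _ => hK.deriv_eq_zero⟩

lemma ConditionK1.integral_comp (hK : ConditionK1 k) (hh : 0 < h) (t : ℝ) :
    ∫ u, k ((t - u) / h) = h := by
  rw [integral_sub_left_eq_self (fun u => k (u / h)) volume t, Measure.integral_comp_div,
    hK.integral_eq_one, abs_of_pos hh, smul_eq_mul, mul_one]

lemma ConditionK1.tendsto_comp (hK : ConditionK1 k) (hh : 0 < h) (t : ℝ) :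
    Tendsto (fun u => -h * k ((t - u) / h)) atTop (𝓝 0) := by
  refine tendsto_const_nhds.congr' ?_
  filter_upwards [eventually_gt_atTop (t + h)] with u hu
  rw [eq_zero_of_notMem_window (fun _ => hK.eq_zero) hh fun hmem => hu.not_ge hmem.2, mul_zero]

lemma ConditionK1.integral_Ioi_deriv (hK : ConditionK1 k) (hh : 0 < h) (t x : ℝ) :
    ∫ u in Ioi x, deriv k ((t - u) / h) = h * k ((t - x) / h) := by
  rw [integral_Ioi_of_hasDerivAt_of_tendsto
    (hK.hasDerivAt_comp hh t x).continuousAt.continuousWithinAt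
    (fun u _ => hK.hasDerivAt_comp hh t u) (hK.integrable_comp hh t).2.integrableOn
    (hK.tendsto_comp hh t)]
  ring

lemma ConditionK1.integral_deriv (hK : ConditionK1 k) (hh : 0 < h) (t : ℝ) :
    ∫ u, deriv k ((t - u) / h) = 0 := by
  have h1 : ∫ u in Ioi (t - 2 * h), deriv k ((t - u) / h) = ∫ u, deriv k ((t - u) / h) := by
    refine setIntegral_eq_integral_of_forall_compl_eq_zero fun u hu => ?_
    refine eq_zero_of_notMem_window (fun _ => hK.deriv_eq_zero) hh fun hmem => hu ?_
    exact lt_of_lt_of_le (by linarith) hmem.1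
  rw [← h1, hK.integral_Ioi_deriv hh, hK.eq_zero, mul_zero]
  rw [show (t - (t - 2 * h)) / h = 2 by field_simp; ring]
  norm_num

/-- Integration by parts in the form of Fubini's theorem, valid for every law `PX`. -/
lemma ConditionK1.integral_deriv_mul_cdf (hK : ConditionK1 k) (hh : 0 < h) (t : ℝ)
    (PX : Measure ℝ) [IsProbabilityMeasure PX] :
    ∫ u, PX.real (Iic u) * deriv k ((t - u) / h) = h * ∫ x, k ((t - x) / h) ∂PX := by
  set S : Set (ℝ × ℝ) := {p | p.2 ≤ p.1} with hS
  have hSm : MeasurableSet S := measurableSet_le measurable_snd measurable_fst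
  have hint : Integrable (S.indicator fun p : ℝ × ℝ => deriv k ((t - p.1) / h))
      (volume.prod PX) := by
    have := (hK.integrable_comp hh t).2.mul_prod (integrable_const (1 : ℝ) (μ := PX))
    simp only [mul_one] at this
    exact this.indicator hSm
  have hswap := integral_integral_swap (μ := volume) (ν := PX)
    (f := fun u x => S.indicator (fun p : ℝ × ℝ => deriv k ((t - p.1) / h)) (u, x)) hint
  have hl : ∀ u, ∫ x, S.indicator (fun p : ℝ × ℝ => deriv k ((t - p.1) / h)) (u, x) ∂PX =
      PX.real (Iic u) * deriv k ((t - u) / h) := by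
    intro u
    have : (fun x => S.indicator (fun p : ℝ × ℝ => deriv k ((t - p.1) / h)) (u, x)) =
        (Iic u).indicator fun _ => deriv k ((t - u) / h) := by
      funext x
      simp only [indicator_apply, hS, mem_ofPred_eq, mem_Iic]
    rw [this, integral_indicator_const _ measurableSet_Iic, smul_eq_mul]
  have hr : ∀ x, ∫ u, S.indicator (fun p : ℝ × ℝ => deriv k ((t - p.1) / h)) (u, x) =
      h * k ((t - x) / h) := by
    intro x
    have : (fun u => S.indicator (fun p : ℝ × ℝ => deriv k ((t - p.1) / h)) (u, x)) =
        (Ici x).indicator fun u => deriv k ((t - u) / h) := by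
      funext u
      simp only [indicator_apply, hS, mem_ofPred_eq, mem_Ici]
    rw [this, integral_indicator measurableSet_Ici, integral_Ici_eq_integral_Ioi,
      hK.integral_Ioi_deriv hh]
  simp only [hl, hr] at hswap
  rw [hswap, integral_const_mul]

/-- For `t ∈ [h, M₀ + h / 2]` the part `[t - h, t - h / 2]` of the window lies in `[0, M₀]`, where
the density of `PX` is at least `ε`; so the kernel smoother of `PX` is at least of the order `ε`. -/
lemma ConditionF1.le_integral_kernel {PX : Measure ℝ} [IsProbabilityMeasure PX] {f₀ : ℝ → ℝ}
    {M₀ ε : ℝ} (hF : ConditionF1 PX f₀ M₀) (hK : ConditionK1 k) (hε : ∀ x ∈ Icc 0 M₀, ε ≤ f₀ x)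
    (hh : 0 < h) (ht : t ∈ Icc h (M₀ + h / 2)) :
    ε * (h * ∫ u in (1 / 2)..1, k u) ≤ ∫ x, k ((t - x) / h) ∂PX := by
  obtain ⟨K, -, ⟨hKb, -⟩, -⟩ := hK.exists_bound
  have hkm : Measurable fun x => k ((t - x) / h) :=
    hK.contDiff.continuous.measurable.comp (by fun_prop)
  have hi := hF.density.integrable_mul hkm fun u => hKb _
  rw [hF.density.integral_eq]
  have hle : t - h ≤ t - h / 2 := by linarith
  have hsub : ∫ x in (t - h)..(t - h / 2), k ((t - x) / h) = h * ∫ u in (1 / 2)..1, k u := by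
    rw [intervalIntegral.integral_comp_sub_left (fun u => k (u / h)) t,
      intervalIntegral.integral_comp_div _ hh.ne', smul_eq_mul]
    congr 2 <;> field_simp <;> ring
  calc ε * (h * ∫ u in (1 / 2)..1, k u)
      = ∫ x in Ioc (t - h) (t - h / 2), k ((t - x) / h) * ε := by
        rw [← hsub, integral_mul_const, intervalIntegral.integral_of_le hle, mul_comm]
    _ ≤ ∫ x in Ioc (t - h) (t - h / 2), k ((t - x) / h) * f₀ x := by
        refine setIntegral_mono_on ((hK.integrable_comp hh t).1.mul_const ε).integrableOn
          hi.integrableOn measurableSet_Ioc fun x hx => ?_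
        refine mul_le_mul_of_nonneg_left (hε x ⟨?_, ?_⟩) (hK.nonneg _)
        · linarith [hx.1, ht.1]
        · linarith [hx.2, ht.2]
    _ ≤ ∫ x, k ((t - x) / h) * f₀ x :=
        setIntegral_le_integral hi
          (ae_of_all _ fun x => mul_nonneg (hK.nonneg _) (hF.density.nonneg x))

end Window

/-! ### The derivative of the population version of the naive estimator -/

/-- Lower bound for the numerator of the derivative of `m₁ / m`, where `m` and `m₁` are the kernel
smoothers of `g` and `F g`. Replacing `g` by a constant `G` near `t` leaves the kernel smoother of
the law with distribution function `F`; the error involves the variation of `g` times the variation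
of `F` over the window. -/
lemma ConditionK1.numerator_lower_bound {k : ℝ → ℝ} (hK : ConditionK1 k) {K : ℝ}
    (hkb : ∀ u, |k u| ≤ K) (hkd : ∀ u, |deriv k u| ≤ K) {PX PT : Measure ℝ}
    [IsProbabilityMeasure PX] [IsProbabilityMeasure PT] {g : ℝ → ℝ} (hg : IsDensity PT g)
    {h t G ω γ : ℝ} (hh : 0 < h) (hω : PX.real (Icc (t - h) (t + h)) ≤ ω)
    (hγ : ∀ u ∈ Icc (t - h) (t + h), |g u - G| ≤ γ)
    (hm : 0 < ∫ u, k ((t - u) / h) * g u) :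
    (∫ u, k ((t - u) / h) * g u) *
        (G * (h * ∫ x, k ((t - x) / h) ∂PX) - K * ω * γ * (2 * h)) ≤
      (∫ u, (PX.real (Iic u) * deriv k ((t - u) / h)) * g u) * (∫ u, k ((t - u) / h) * g u) -
        (∫ u, (PX.real (Iic u) * k ((t - u) / h)) * g u) * ∫ u, deriv k ((t - u) / h) * g u := by
  set F : ℝ → ℝ := fun u => PX.real (Iic u) with hF
  have hFmono : Monotone F := fun u v huv => measureReal_mono (Iic_subset_Iic.2 huv)
  have hFm : Measurable F := hFmono.measurable
  have hF0 : ∀ u, 0 ≤ F u := fun u => measureReal_nonneg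
  have hF1 : ∀ u, |F u| ≤ 1 := fun u => by
    rw [abs_of_nonneg (hF0 u)]; exact measureReal_le_one
  have hκm : Measurable fun u => k ((t - u) / h) :=
    hK.contDiff.continuous.measurable.comp (by fun_prop)
  have hκ'm : Measurable fun u => deriv k ((t - u) / h) :=
    hK.contDiff_deriv.continuous.measurable.comp (by fun_prop)
  have hF_mul_bound : ∀ φ : ℝ → ℝ, (∀ u, |φ u| ≤ K) → ∀ u, |F u * φ ((t - u) / h)| ≤ 1 * K :=
    fun φ hφ u => by
      rw [abs_mul]
      exact mul_le_mul (hF1 u) (hφ _) (abs_nonneg _) one_pos.le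
  have i1 := hg.integrable_mul hκm fun u => hkb _
  have i2 := hg.integrable_mul hκ'm fun u => hkd _
  have i3 : Integrable fun u => (F u * k ((t - u) / h)) * g u :=
    hg.integrable_mul (hFm.mul hκm) (hF_mul_bound k hkb)
  have i4 : Integrable fun u => (F u * deriv k ((t - u) / h)) * g u :=
    hg.integrable_mul (hFm.mul hκ'm) (hF_mul_bound _ hkd)
  set m := ∫ u, k ((t - u) / h) * g u with hmdef
  set m₁ := ∫ u, (F u * k ((t - u) / h)) * g u with hm₁
  set ρ := m₁ / m with hρ
  have hker : ∀ u, u ∉ Icc (t - h) (t + h) → k ((t - u) / h) = 0 := fun u hu =>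
    eq_zero_of_notMem_window (fun _ => hK.eq_zero) hh hu
  have hker' : ∀ u, u ∉ Icc (t - h) (t + h) → deriv k ((t - u) / h) = 0 := fun u hu =>
    eq_zero_of_notMem_window (fun _ => hK.deriv_eq_zero) hh hu
  have hkg : ∀ u, 0 ≤ k ((t - u) / h) * g u := fun u => mul_nonneg (hK.nonneg _) (hg.nonneg u)
  -- the weighted average `ρ` of `F` over the window lies between the extreme values of `F` there
  have hρ1 : F (t - h) ≤ ρ := by
    rw [hρ, le_div_iff₀ hm, hmdef, ← integral_const_mul]
    refine integral_mono (i1.const_mul _) i3 fun u => ?_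
    simp only [mul_assoc]
    by_cases hu : u ∈ Icc (t - h) (t + h)
    · exact mul_le_mul_of_nonneg_right (hFmono hu.1) (hkg u)
    · simp [hker u hu]
  have hρ2 : ρ ≤ F (t + h) := by
    rw [hρ, div_le_iff₀ hm, hmdef, ← integral_const_mul]
    refine integral_mono i3 (i1.const_mul _) fun u => ?_
    simp only [mul_assoc]
    by_cases hu : u ∈ Icc (t - h) (t + h)
    · exact mul_le_mul_of_nonneg_right (hFmono hu.2) (hkg u)
    · simp [hker u hu]
  have hFω : F (t + h) - F (t - h) ≤ ω := by
    have hsub : Iic (t + h) ⊆ Iic (t - h) ∪ Icc (t - h) (t + h) := fun u hu =>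
      (le_total u (t - h)).imp id fun h1 => ⟨h1, hu⟩
    have := (measureReal_mono hsub (measure_ne_top PX _)).trans (measureReal_union_le _ _)
    simp only [hF]
    linarith
  have hγ0 : 0 ≤ γ := (abs_nonneg _).trans (hγ t ⟨by linarith, by linarith⟩)
  have hK0 : 0 ≤ K := (abs_nonneg _).trans (hkb 0)
  have hω0 : 0 ≤ ω := measureReal_nonneg.trans hω
  have hi' := (hK.integrable_comp hh t).2
  have i5 : Integrable fun u => F u * deriv k ((t - u) / h) :=
    hi'.bdd_mul hFm.aestronglyMeasurable (ae_of_all _ hF1)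
  have i6 : Integrable fun u => ((F u - ρ) * deriv k ((t - u) / h)) * (g u - G) := by
    have e : (fun u => ((F u - ρ) * deriv k ((t - u) / h)) * (g u - G)) = fun u =>
        ((F u * deriv k ((t - u) / h)) * g u - ρ * (deriv k ((t - u) / h) * g u)) -
          (G * (F u * deriv k ((t - u) / h)) - G * ρ * deriv k ((t - u) / h)) := by
      funext u; ring
    rw [e]
    exact (i4.sub (i2.const_mul _)).sub ((i5.const_mul _).sub (hi'.const_mul _))
  have herr : |∫ u, ((F u - ρ) * deriv k ((t - u) / h)) * (g u - G)| ≤ K * ω * γ * (2 * h) := by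
    refine abs_integral_le_of_window (t := t) hh (fun u hu => ?_) fun u hu => ?_
    · rw [hker' u hu]; ring
    · have h1 : |F u - ρ| ≤ ω := by
        rw [abs_le]
        constructor <;> linarith [hFmono hu.1, hFmono hu.2]
      rw [abs_mul, abs_mul, mul_comm K ω]
      gcongr
      · exact hkd _
      · exact hγ u hu
  have hdecomp : (∫ u, (F u * deriv k ((t - u) / h)) * g u) -
      ρ * (∫ u, deriv k ((t - u) / h) * g u) = G * (h * ∫ x, k ((t - x) / h) ∂PX) +
        ∫ u, ((F u - ρ) * deriv k ((t - u) / h)) * (g u - G) := by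
    have e1 : ∫ u, ((F u * deriv k ((t - u) / h)) * g u - ρ * (deriv k ((t - u) / h) * g u)) =
        ∫ u, ((G * (F u * deriv k ((t - u) / h)) - G * ρ * deriv k ((t - u) / h)) +
          ((F u - ρ) * deriv k ((t - u) / h)) * (g u - G)) :=
      integral_congr_ae (ae_of_all _ fun u => by simp only; ring)
    have i7 : Integrable fun u =>
        G * (F u * deriv k ((t - u) / h)) - G * ρ * deriv k ((t - u) / h) :=
      (i5.const_mul _).sub (hi'.const_mul _)
    rw [integral_sub i4 (i2.const_mul _), integral_add i7 i6,
      integral_sub (i5.const_mul _) (hi'.const_mul _), integral_const_mul, integral_const_mul,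
      integral_const_mul, hK.integral_deriv hh, mul_zero, sub_zero,
      hK.integral_deriv_mul_cdf hh t PX] at e1
    exact e1
  have hm₁ρ : m₁ = ρ * m := by rw [hρ, div_mul_cancel₀ _ hm.ne']
  have hfinal : (∫ u, (F u * deriv k ((t - u) / h)) * g u) * m -
      m₁ * ∫ u, deriv k ((t - u) / h) * g u = m * ((∫ u, (F u * deriv k ((t - u) / h)) * g u) -
        ρ * ∫ u, deriv k ((t - u) / h) * g u) := by
    rw [hm₁ρ]; ring
  rw [hfinal, hdecomp]
  refine mul_le_mul_of_nonneg_left ?_ hm.le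
  linarith [(abs_le.1 herr).1]

/-- Bounds on the expectations of the estimators and their derivatives, uniformly for
`t ∈ [h, M₀ + h]` and small `h`. The numerator of the derivative of the ratio of expectations is
bounded away from zero up to `M₀ + h / 2` and asymptotically nonnegative up to `M₀ + h`. -/
lemma exists_population_bounds {PX PT : Measure ℝ} [IsProbabilityMeasure PX]
    [IsProbabilityMeasure PT] {f₀ g k : ℝ → ℝ} {M₀ : ℝ} (hF : ConditionF1 PX f₀ M₀)
    (hG : ConditionG1 PT g M₀) (hK : ConditionK1 k) :
    ∃ δ > 0, ∃ c > 0, ∃ C > 0, ∃ D > 0,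
      (∀ a b, a ≤ b → b ≤ M₀ + δ → PT.real (Icc a b) ≤ C * (b - a)) ∧
      ∀ η > 0, ∃ h₁ > 0, ∀ h ∈ Ioc 0 h₁, ∀ t ∈ Icc h (M₀ + h),
        (h * kernelMean k (fun _ => 1) PX PT h t ∈ Icc c C) ∧
        |kernelMean (deriv k) (statusWeight 1) PX PT h t| ≤ C / h ∧
        |kernelMean (deriv k) (fun _ => 1) PX PT h t| ≤ C / h ∧
        -η ≤ kernelMean (deriv k) (statusWeight 1) PX PT h t *
            (h * kernelMean k (fun _ => 1) PX PT h t) -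
          (h * kernelMean k (statusWeight 1) PX PT h t) *
            kernelMean (deriv k) (fun _ => 1) PX PT h t ∧
        (t ≤ M₀ + h / 2 → D ≤ kernelMean (deriv k) (statusWeight 1) PX PT h t *
            (h * kernelMean k (fun _ => 1) PX PT h t) -
          (h * kernelMean k (statusWeight 1) PX PT h t) *
            kernelMean (deriv k) (fun _ => 1) PX PT h t) := by
  have hM₀ := hF.pos
  obtain ⟨δ, hδ, ε, hε, C, hC, hgb, hglip⟩ := hG.exists_bounds hM₀
  obtain ⟨ε', hε', hf₀⟩ := hF.away_from_zero
  obtain ⟨K, hKpos, ⟨hkb, -⟩, hkd, -⟩ := hK.exists_bound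
  set q := ∫ u in (1 / 2)..1, k u with hq
  have hqpos : 0 < q := hK.upper_half_mass_pos
  have hkm := hK.contDiff.continuous.measurable
  have hk'm := hK.contDiff_deriv.continuous.measurable
  refine ⟨δ, hδ, ε, hε, C + 2 * K * C, by positivity, ε * (ε * (ε' * q) / 2), by positivity,
    fun a b hab hb => ?_, fun η hη => ?_⟩
  · refine (hG.real_Icc_le hC.le (fun u hu => (hgb u hu).2) hab hb).trans ?_
    have : 0 ≤ 2 * K * C := by positivity
    exact mul_le_mul_of_nonneg_right (by linarith) (sub_nonneg.2 hab)
  -- `ω` is chosen so that the error term is dominated by both `η` and the main term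
  set ω := min (η / (C * (K * (2 * C) * 2))) (ε * (ε' * q) / 2 / (K * (2 * C) * 2)) with hω
  have hωpos : 0 < ω := by positivity
  have hω1 : C * (K * ω * (2 * C) * 2) ≤ η := by
    have : ω ≤ η / (C * (K * (2 * C) * 2)) := min_le_left _ _
    rw [le_div_iff₀ (by positivity)] at this
    linarith
  have hω2 : K * ω * (2 * C) * 2 ≤ ε * (ε' * q) / 2 := by
    have : ω ≤ ε * (ε' * q) / 2 / (K * (2 * C) * 2) := min_le_right _ _
    rw [le_div_iff₀ (by positivity)] at this
    linarith
  obtain ⟨δ', hδ', hsmall⟩ := hF.density.exists_real_Icc_le hωpos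
  refine ⟨min (δ / 2) (δ' / 4), by positivity, fun h hh t ht => ?_⟩
  have hh0 : 0 < h := hh.1
  have hhδ : h ≤ δ / 2 := hh.2.trans (min_le_left _ _)
  have hhδ' : h ≤ δ' / 4 := hh.2.trans (min_le_right _ _)
  have hwin : ∀ u ∈ Icc (t - h) (t + h), u ∈ Icc 0 (M₀ + δ) := fun u hu =>
    ⟨by linarith [hu.1, ht.1], by linarith [hu.2, ht.2]⟩
  set v := min t M₀ with hv
  have hvmem : v ∈ Icc 0 M₀ := ⟨le_min (hh0.le.trans ht.1) hM₀.le, min_le_right _ _⟩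
  have hvt : |t - v| ≤ h := by
    rw [abs_of_nonneg (sub_nonneg.2 (min_le_left _ _)), hv]
    rcases le_total t M₀ with h1 | h1
    · rw [min_eq_left h1]; linarith
    · rw [min_eq_right h1]; linarith [ht.2]
  have hγ : ∀ u ∈ Icc (t - h) (t + h), |g u - g v| ≤ 2 * C * h := by
    intro u hu
    have h1 : |u - t| ≤ h := abs_le.2 ⟨by linarith [hu.1], by linarith [hu.2]⟩
    have h2 : |u - v| ≤ 2 * h := by linarith [abs_sub_le u t v]
    calc |g u - g v| ≤ C * |u - v| := hglip u (hwin u hu) v hvmem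
      _ ≤ C * (2 * h) := by gcongr
      _ = 2 * C * h := by ring
  have hGv : ε ≤ g v := (hgb v ⟨hvmem.1, by linarith [hvmem.2]⟩).1
  have hker : ∀ φ : ℝ → ℝ, (∀ u, 1 < |u| → φ u = 0) → ∀ u, u ∉ Icc (t - h) (t + h) →
      φ ((t - u) / h) = 0 := fun φ hφ u hu => eq_zero_of_notMem_window hφ hh0 hu
  have i1 := hG.density.integrable_mul (ψ := fun u => k ((t - u) / h)) (hkm.comp (by fun_prop))
    fun u => hkb _
  have iκ := (hK.integrable_comp hh0 t).1
  set m := ∫ u, k ((t - u) / h) * g u with hm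
  have hm1 : ε * h ≤ m := by
    rw [← hK.integral_comp hh0 t, ← integral_const_mul]
    refine integral_mono (iκ.const_mul _) i1 fun u => ?_
    simp only
    by_cases hu : u ∈ Icc (t - h) (t + h)
    · rw [mul_comm]
      exact mul_le_mul_of_nonneg_left (hgb u (hwin u hu)).1 (hK.nonneg _)
    · simp [hker k (fun _ => hK.eq_zero) u hu]
  have hm2 : m ≤ C * h := by
    rw [← hK.integral_comp hh0 t, ← integral_const_mul]
    refine integral_mono i1 (iκ.const_mul _) fun u => ?_
    simp only
    by_cases hu : u ∈ Icc (t - h) (t + h)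
    · rw [mul_comm C]
      exact mul_le_mul_of_nonneg_left (hgb u (hwin u hu)).2 (hK.nonneg _)
    · simp [hker k (fun _ => hK.eq_zero) u hu]
  have hmpos : 0 < m := (mul_pos hε hh0).trans_le hm1
  have hF1 : ∀ u, |PX.real (Iic u)| ≤ 1 := fun u => by
    rw [abs_of_nonneg measureReal_nonneg]; exact measureReal_le_one
  have hd : ∀ w : ℝ → ℝ, (∀ u, |w u| ≤ 1) →
      |h⁻¹ ^ 2 * ∫ u, (w u * deriv k ((t - u) / h)) * g u| ≤ (C + 2 * K * C) / h := by
    intro w hw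
    have h1 : |∫ u, (w u * deriv k ((t - u) / h)) * g u| ≤ 1 * K * C * (2 * h) := by
      refine abs_integral_le_of_window (t := t) hh0 (fun u hu => ?_) fun u hu => ?_
      · rw [hker _ (fun _ => hK.deriv_eq_zero) u hu]; ring
      · have hgu := hgb u (hwin u hu)
        rw [abs_mul, abs_mul, abs_of_nonneg (hε.le.trans hgu.1)]
        exact mul_le_mul (mul_le_mul (hw u) (hkd _) (abs_nonneg _) one_pos.le) hgu.2
          (hε.le.trans hgu.1) (by positivity)
    rw [abs_mul, abs_of_nonneg (by positivity : 0 ≤ h⁻¹ ^ 2)]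
    calc h⁻¹ ^ 2 * |∫ u, (w u * deriv k ((t - u) / h)) * g u|
        ≤ h⁻¹ ^ 2 * (1 * K * C * (2 * h)) := by gcongr
      _ = 2 * K * C / h := by field_simp
      _ ≤ _ := by gcongr; linarith
  have e1 := kernelMean_one (PX := PX) (φ := k) hG.density h t
  have e2 := kernelMean_one (PX := PX) (φ := deriv k) hG.density h t
  have e3 := kernelMean_statusWeight (PX := PX) hG.density hkm hkb h t
  have e4 := kernelMean_statusWeight (PX := PX) hG.density hk'm hkd h t
  have hnum := hK.numerator_lower_bound hkb hkd (PX := PX) hG.density hh0 (G := g v)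
    (hsmall (t - h) (t + h) (by linarith)) hγ hmpos
  rw [← hm] at e1 hnum
  set J := ∫ x, k ((t - x) / h) ∂PX with hJ
  have hJ0 : 0 ≤ J := integral_nonneg fun x => hK.nonneg _
  have hscale : kernelMean (deriv k) (statusWeight 1) PX PT h t *
        (h * kernelMean k (fun _ => 1) PX PT h t) -
      (h * kernelMean k (statusWeight 1) PX PT h t) *
        kernelMean (deriv k) (fun _ => 1) PX PT h t =
      h⁻¹ ^ 3 * ((∫ u, (PX.real (Iic u) * deriv k ((t - u) / h)) * g u) * m -
        (∫ u, (PX.real (Iic u) * k ((t - u) / h)) * g u) * ∫ u, deriv k ((t - u) / h) * g u) := by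
    rw [e1, e2, e3, e4]
    field_simp
  have hlow : m / h * (g v * (J / h) - K * ω * (2 * C) * 2) ≤
      kernelMean (deriv k) (statusWeight 1) PX PT h t *
        (h * kernelMean k (fun _ => 1) PX PT h t) -
      (h * kernelMean k (statusWeight 1) PX PT h t) *
        kernelMean (deriv k) (fun _ => 1) PX PT h t := by
    rw [hscale]
    calc m / h * (g v * (J / h) - K * ω * (2 * C) * 2)
        = h⁻¹ ^ 3 * (m * (g v * (h * J) - K * ω * (2 * C * h) * (2 * h))) := by field_simp
      _ ≤ _ := mul_le_mul_of_nonneg_left hnum (by positivity)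
  have hmh : m / h ∈ Icc ε C := ⟨(le_div_iff₀ hh0).2 hm1, (div_le_iff₀ hh0).2 hm2⟩
  have hgv0 : 0 ≤ g v := hε.le.trans hGv
  refine ⟨?_, ?_, ?_, ?_, fun htM => ?_⟩
  · have : h * kernelMean k (fun _ => 1) PX PT h t = m / h := by rw [e1]; field_simp
    rw [this]
    exact ⟨hmh.1, hmh.2.trans (by linarith [show 0 ≤ 2 * K * C by positivity])⟩
  · rw [e4]
    exact hd _ hF1
  · rw [e2]
    simpa using hd (fun _ => 1) (by simp)
  · refine le_trans ?_ hlow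
    have h1 : 0 ≤ m / h * (g v * (J / h)) := by positivity
    have h2 : m / h * (K * ω * (2 * C) * 2) ≤ C * (K * ω * (2 * C) * 2) := by
      gcongr
      exact hmh.2
    linarith
  · refine le_trans ?_ hlow
    have hJq : ε' * q ≤ J / h := by
      rw [le_div_iff₀ hh0]
      have := hF.le_integral_kernel hK hf₀ hh0 (t := t) ⟨ht.1, htM⟩
      linarith
    have h1 : ε * (ε' * q) ≤ g v * (J / h) := by gcongr
    have h2 : ε * (ε' * q) / 2 ≤ g v * (J / h) - K * ω * (2 * C) * 2 := by linarith
    exact mul_le_mul hmh.1 h2 (by positivity) (hε.le.trans hmh.1)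

/-! ### The estimators coincide with probability tending to one -/

lemma ConditionG1.real_Iic_le {PT : Measure ℝ} [IsProbabilityMeasure PT] {g : ℝ → ℝ} {M₀ : ℝ}
    (hG : ConditionG1 PT g M₀) (r : ℝ) : PT.real (Iic r) ≤ PT.real (Icc 0 r) := by
  have hneg : PT (Ici 0)ᶜ = 0 := by
    rw [← hG.support_eq]
    exact Measure.measure_compl_support
  have hsub : Iic r ⊆ Icc 0 r ∪ (Ici 0)ᶜ := fun u hu => by
    by_cases hu0 : 0 ≤ u
    · exact Or.inl ⟨hu0, hu⟩
    · exact Or.inr hu0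
  have := (measureReal_mono hsub (measure_ne_top PT _)).trans (measureReal_union_le _ _)
  rwa [measureReal_def PT (Ici 0)ᶜ, hneg, ENNReal.toReal_zero, add_zero] at this

/-- The relative number of inspection times in the boundary region is negligible. -/
lemma whp_boundary_count {Ω : Type*} [MeasurableSpace Ω] {P : Measure Ω} [IsProbabilityMeasure P]
    {X T : ℕ → Ω → ℝ} {PX PT : Measure ℝ} (hM : Model P X T PX PT) {g : ℝ → ℝ} {M₀ : ℝ}
    (hG : ConditionG1 PT g M₀) {C δ : ℝ} (hδ : 0 < δ)
    (hPT : ∀ a b, a ≤ b → b ≤ δ → PT.real (Icc a b) ≤ C * (b - a)) {h : ℕ → ℝ}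
    (hh : Tendsto h atTop (𝓝 0)) (hpos : ∀ᶠ n in atTop, 0 < h n) {κ : ℝ} (hκ : 0 < κ) :
    WHP P fun n ω => (1 / (n : ℝ)) * ∑ j ∈ Finset.range n,
      (Iic (2 * h n)).indicator (fun _ => (1 : ℝ)) (T j ω) ≤ κ := by
  obtain ⟨-, hPT'⟩ := hM.isProbabilityMeasure
  have hlim : Tendsto (fun n => C * (2 * h n) / κ) atTop (𝓝 0) := by
    have := ((hh.const_mul 2).const_mul C).div_const κ
    simpa using this
  refine WHP.of_real_le hlim ?_
  filter_upwards [eventually_gt_atTop 0, hpos, hh.eventually_le_const (half_pos hδ)]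
    with n hn hn1 hn2
  set N : Ω → ℝ := fun ω => (1 / (n : ℝ)) * ∑ j ∈ Finset.range n,
    (Iic (2 * h n)).indicator (fun _ => (1 : ℝ)) (T j ω) with hN
  have hn' : (n : ℝ) ≠ 0 := by positivity
  have hS : ∀ j, MeasurableSet (T j ⁻¹' Iic (2 * h n)) := fun j =>
    hM.measurable_T j measurableSet_Iic
  have hi : ∀ j, Integrable (fun ω => (Iic (2 * h n)).indicator (fun _ => (1 : ℝ)) (T j ω)) P :=
    fun j => (integrable_const (1 : ℝ)).indicator (hS j)
  have hE : ∀ j, ∫ ω, (Iic (2 * h n)).indicator (fun _ => (1 : ℝ)) (T j ω) ∂P =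
      PT.real (Iic (2 * h n)) := by
    intro j
    have := integral_indicator_const (μ := P) (1 : ℝ) (hS j)
    rw [smul_eq_mul, mul_one] at this
    rw [← hM.law_T j, map_measureReal_apply (hM.measurable_T j) measurableSet_Iic]
    exact this
  have hint : ∫ ω, N ω ∂P = PT.real (Iic (2 * h n)) := by
    rw [hN, integral_const_mul, integral_finsetSum _ fun j _ => hi j]
    simp only [hE, Finset.sum_const, Finset.card_range, nsmul_eq_mul]
    field_simp
  have hNi : Integrable N P := (integrable_finsetSum _ fun j _ => hi j).const_mul _
  have hN0 : 0 ≤ᵐ[P] N := ae_of_all _ fun ω =>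
    mul_nonneg (by positivity) (Finset.sum_nonneg fun j _ => indicator_nonneg (by simp) _)
  have hmark := mul_meas_ge_le_integral_of_nonneg hN0 hNi κ
  rw [hint] at hmark
  have hle := (hG.real_Iic_le (2 * h n)).trans (hPT 0 (2 * h n) (by linarith) (by linarith))
  rw [sub_zero] at hle
  rw [le_div_iff₀ hκ, mul_comm]
  refine le_trans ?_ (hmark.trans hle)
  exact mul_le_mul_of_nonneg_left (measureReal_mono fun ω hω => (not_le.1 hω).le) hκ.le

/-- If every event time is at most `M₀`, an observation with `X > T` has `T < M₀`, so that `ĝ_{n,0}`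
vanishes beyond `M₀ + h`. -/
lemma ConditionK1.gHatSub_zero_eq_zero {k : ℝ → ℝ} (hK : ConditionK1 k) {h M₀ u : ℝ} (hh : 0 < h)
    (hM₀ : 0 ≤ M₀) (n : ℕ) {x y : ℕ → ℝ} (hx : ∀ j, x j ≤ M₀) (hu : M₀ + h < u) :
    gHatSub k h n x y 0 u = 0 := by
  rw [gHatSub_eq_sum, Finset.sum_eq_zero, mul_zero]
  intro j _
  by_cases hxy : x j ≤ y j
  · simp [statusWeight, delta, hxy]
  · have : 1 < |(u - y j) / h| := by
      refine lt_of_lt_of_le ?_ (le_abs_self _)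
      rw [lt_div_iff₀ hh]
      linarith [hx j]
    rw [kernelAt, if_neg (by linarith), hK.eq_zero this]
    simp

/-- With probability tending to one the two estimators coincide on `[m, M₀]` and on the part of
`(M₀ + h, ∞)` where the naive estimator is well defined. -/
lemma whp_msle_eq_naive {Ω : Type*} [MeasurableSpace Ω] {P : Measure Ω} [IsProbabilityMeasure P]
    {X T : ℕ → Ω → ℝ} {PX PT : Measure ℝ} {f₀ g k : ℝ → ℝ} {M₀ c α : ℝ}
    (hM : Model P X T PX PT) (hF : ConditionF1 PX f₀ M₀) (hG : ConditionG1 PT g M₀)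
    (hK : ConditionK1 k) (hc : 0 < c) (hα : α ∈ Ioo (0 : ℝ) (1 / 3)) {m : ℝ} (hm : 0 < m)
    (hmM : m ≤ M₀) :
    WHP P fun n ω =>
      (∀ t ∈ Icc m M₀, gHatRV k c α X T n t ω ≠ 0 ∧
        naiveRV k c α X T n t ω = msleRV k c α X T n t ω) ∧
      ∀ t > M₀ + bandwidth c α n, gHatRV k c α X T n t ω ≠ 0 →
        naiveRV k c α X T n t ω = msleRV k c α X T n t ω := by
  obtain ⟨hPX, hPT⟩ := hM.isProbabilityMeasure
  have hM₀ := hF.pos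
  obtain ⟨δ, hδ, c₀, hc₀, C₀, hC₀, D, hD, hPTle, hpop⟩ := exists_population_bounds hF hG hK
  obtain ⟨K, -, ⟨hkb, hkL⟩, hkd, hkdL⟩ := hK.exists_bound
  obtain ⟨B, hB, hkern⟩ := hK.exists_bound_kernelAt
  have hlim := tendsto_bandwidth (c := c) hα.1
  -- constants for the sample versions, from those for the expectations
  set c₂ := c₀ / 2 with hc₂
  set C := C₀ + c₀ / 2 with hC
  set E := D / 2 * c₂ ^ 2 / C ^ 2 with hE
  have hc₂pos : 0 < c₂ := half_pos hc₀
  have hCpos : 0 < C := by positivity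
  have hEpos : 0 < E := by positivity
  set η := min (D / 2) (E / 2) / (2 * (C + C₀)) with hη
  have hηpos : 0 < η := by positivity
  have hη1 : 2 * η * (C + C₀) = min (D / 2) (E / 2) := by rw [hη]; field_simp
  set κ := D / 2 / C ^ 2 * c₂ * (m / 2) ^ 2 / 2 with hκ
  have hκpos : 0 < κ := by positivity
  obtain ⟨h₁, hh₁, hpop⟩ := hpop (E / 2) (half_pos hEpos)
  have hconc : ∀ φ : ℝ → ℝ, Measurable φ → (∀ u, |φ u| ≤ K) → (∀ u, 1 < |u| → φ u = 0) →
      (∀ u v, |φ u - φ v| ≤ K * |u - v|) → ∀ w : ℝ × ℝ → ℝ, Measurable w → (∀ z, |w z| ≤ 1) →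
      WHP P fun n ω => ∀ t ∈ Icc 0 (M₀ + δ / 2),
        |kernelAverage φ w (bandwidth c α n) n (fun j => X j ω) (fun j => T j ω) t -
          kernelMean φ w PX PT (bandwidth c α n) t| ≤ η := by
    intro φ hφ hφb hφ0 hφL w hw hwb
    refine whp_kernelAverage hM (h₀ := δ / 2) (C := C₀ * 2) hφ hw hφb hφ0 hwb hφL (half_pos hδ)
      (fun t ht h hh => ?_) hc hα (by positivity) hηpos
    refine (hPTle _ _ (by linarith [hh.1]) (by linarith [hh.2, ht.2])).trans_eq ?_
    ring
  have hk0 : ∀ u, 1 < |u| → k u = 0 := fun _ => hK.eq_zero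
  have hk'0 : ∀ u, 1 < |u| → deriv k u = 0 := fun _ => hK.deriv_eq_zero
  have hkm := hK.contDiff.continuous.measurable
  have hk'm := hK.contDiff_deriv.continuous.measurable
  have hw1 : ∀ z : ℝ × ℝ, |(fun _ => (1 : ℝ)) z| ≤ 1 := fun _ => by simp
  have g1 := hconc k hkm hkb hk0 hkL _ (measurable_statusWeight 1) (abs_statusWeight_le 1)
  have g2 := hconc k hkm hkb hk0 hkL _ measurable_const hw1
  have g3 := hconc _ hk'm hkd hk'0 hkdL _ (measurable_statusWeight 1) (abs_statusWeight_le 1)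
  have g4 := hconc _ hk'm hkd hk'0 hkdL _ measurable_const hw1
  have g5 := whp_boundary_count hM hG (δ := M₀ + δ) (by positivity) hPTle hlim
    ((eventually_gt_atTop 0).mono fun n hn => bandwidth_pos hc hn)
    (show 0 < κ / (3 * B) by positivity)
  have g6 : WHP P fun (_ : ℕ) ω => ∀ j, X j ω ≤ M₀ := by
    refine WHP.of_ae fun _ => ae_all_iff.2 fun j => ?_
    have h1 : ∀ᵐ x ∂PX, x ∈ Icc 0 M₀ := by
      rw [← hF.support_eq]
      exact Measure.support_mem_ae
    rw [← hM.law_X j] at h1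
    exact (ae_of_ae_map (hM.measurable_X j).aemeasurable h1).mono fun ω hω => hω.2
  refine ((((((g1.and g2).and g3).and g4).and g5).and g6)).mono ?_
  filter_upwards [eventually_gt_atTop 0, hlim.eventually_le_const hh₁,
    hlim.eventually_le_const (half_pos hδ), hlim.eventually_le_const (half_pos hm),
    hlim.eventually_le_const (show 0 < c₀ / 2 / η by positivity)] with n hn hn1 hn2 hn3 hn4 ω hω
  obtain ⟨⟨⟨⟨⟨k1, k2⟩, k3⟩, k4⟩, k5⟩, k6⟩ := hω
  have hh : 0 < bandwidth c α n := bandwidth_pos hc hn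
  simp only [gHatRV, naiveRV, msleRV]
  set h := bandwidth c α n with hhdef
  set x : ℕ → ℝ := fun j => X j ω
  set y : ℕ → ℝ := fun j => T j ω
  rw [le_div_iff₀ hηpos] at hn4
  have hhm : h < m := by linarith
  have hmem : ∀ u ∈ Ioc h (M₀ + h), u ∈ Icc 0 (M₀ + δ / 2) := fun u hu =>
    ⟨hh.le.trans hu.1.le, by linarith [hu.2]⟩
  have hgH : ∀ u > h, 0 ≤ gHat k h n x y u := fun u hu =>
    add_nonneg (hK.gHatSub_nonneg hh n x y 0 hu) (hK.gHatSub_nonneg hh n x y 1 hu)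
  have hclose : ∀ w : ℝ × ℝ → ℝ, ∀ u, |kernelAverage k w h n x y u - kernelMean k w PX PT h u| ≤ η →
      |h * kernelAverage k w h n x y u - h * kernelMean k w PX PT h u| ≤ h * η := fun w u hu => by
    rw [← mul_sub, abs_mul, abs_of_pos hh]
    gcongr
  have hb : ∀ u ∈ Ioc h (M₀ + h), gHat k h n x y u ∈ Icc c₂ C := by
    intro u hu
    obtain ⟨⟨p1, p1'⟩, -⟩ := hpop h ⟨hh, hn1⟩ u ⟨hu.1.le, hu.2⟩
    have := abs_le.1 (hclose _ u (k2 u (hmem u hu)))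
    rw [gHat_eq_kernelAverage k hh n x y hu.1]
    constructor <;> linarith [this.1, this.2]
  have hnumall : ∀ u ∈ Ioc h (M₀ + h),
      |(kernelAverage (deriv k) (statusWeight 1) h n x y u * gHat k h n x y u -
        gHatSub k h n x y 1 u * kernelAverage (deriv k) (fun _ => 1) h n x y u) -
      (kernelMean (deriv k) (statusWeight 1) PX PT h u *
          (h * kernelMean k (fun _ => 1) PX PT h u) -
        (h * kernelMean k (statusWeight 1) PX PT h u) *
          kernelMean (deriv k) (fun _ => 1) PX PT h u)| ≤ min (D / 2) (E / 2) := by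
    intro u hu
    obtain ⟨-, p2, p3, -⟩ := hpop h ⟨hh, hn1⟩ u ⟨hu.1.le, hu.2⟩
    have q1 := hclose _ u (k1 u (hmem u hu))
    have q2 := hclose _ u (k2 u (hmem u hu))
    have q3 := k3 u (hmem u hu)
    have q4 := k4 u (hmem u hu)
    rw [← gHatSub_eq_kernelAverage k hh n x y 1 hu.1] at q1
    rw [← gHat_eq_kernelAverage k hh n x y hu.1] at q2
    have hbC : |gHat k h n x y u| ≤ C := by
      rw [abs_of_nonneg (hgH u hu.1)]; exact (hb u hu).2
    have haC : |gHatSub k h n x y 1 u| ≤ C := by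
      rw [abs_of_nonneg (hK.gHatSub_nonneg hh n x y 1 hu.1)]
      exact (le_add_of_nonneg_left (hK.gHatSub_nonneg hh n x y 0 hu.1)).trans (hb u hu).2
    set a := gHatSub k h n x y 1 u
    set b := gHat k h n x y u
    set a' := kernelAverage (deriv k) (statusWeight 1) h n x y u
    set b' := kernelAverage (deriv k) (fun _ => 1) h n x y u
    set A := h * kernelMean k (statusWeight 1) PX PT h u
    set Bm := h * kernelMean k (fun _ => 1) PX PT h u
    set A' := kernelMean (deriv k) (statusWeight 1) PX PT h u
    set B' := kernelMean (deriv k) (fun _ => 1) PX PT h u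
    -- the means of the derivatives are only bounded by a multiple of `1 / h`, which the factor `h`
    -- in the concentration bound for the estimators themselves compensates
    have r1 : |(a' - A') * b| ≤ η * C := by
      rw [abs_mul]; exact mul_le_mul q3 hbC (abs_nonneg _) hηpos.le
    have r2 : |A' * (b - Bm)| ≤ C₀ / h * (h * η) := by
      rw [abs_mul]; exact mul_le_mul p2 q2 (abs_nonneg _) (by positivity)
    have r3 : |a * (b' - B')| ≤ C * η := by
      rw [abs_mul]; exact mul_le_mul haC q4 (abs_nonneg _) hCpos.le
    have r4 : |(a - A) * B'| ≤ (h * η) * (C₀ / h) := by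
      rw [abs_mul]; exact mul_le_mul q1 p3 (abs_nonneg _) (by positivity)
    have e1 : C₀ / h * (h * η) = C₀ * η := by field_simp
    rw [e1] at r2
    rw [mul_comm (h * η), e1] at r4
    rw [← hη1, show a' * b - a * b' - (A' * Bm - A * B') =
      (a' - A') * b + A' * (b - Bm) - (a * (b' - B') + (a - A) * B') by ring]
    rw [abs_le] at r1 r2 r3 r4 ⊢
    constructor <;> linarith
  have hnum : ∀ u ∈ Ioc h (M₀ + h / 2), D / 2 ≤
      kernelAverage (deriv k) (statusWeight 1) h n x y u * gHat k h n x y u -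
        gHatSub k h n x y 1 u * kernelAverage (deriv k) (fun _ => 1) h n x y u := by
    intro u hu
    have hu' : u ∈ Ioc h (M₀ + h) := ⟨hu.1, hu.2.trans (by linarith)⟩
    obtain ⟨-, -, -, -, p⟩ := hpop h ⟨hh, hn1⟩ u ⟨hu'.1.le, hu'.2⟩
    have := (abs_le.1 ((hnumall u hu').trans (min_le_left _ _))).1
    linarith [p hu.2]
  have hnum' : ∀ u ∈ Icc (M₀ + h / 2) (M₀ + h), -(D / 2 * c₂ ^ 2 / C ^ 2) ≤
      kernelAverage (deriv k) (statusWeight 1) h n x y u * gHat k h n x y u -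
        gHatSub k h n x y 1 u * kernelAverage (deriv k) (fun _ => 1) h n x y u := by
    intro u hu
    have hu' : u ∈ Ioc h (M₀ + h) := ⟨by linarith [hu.1], hu.2⟩
    obtain ⟨-, -, -, p, -⟩ := hpop h ⟨hh, hn1⟩ u ⟨hu'.1.le, hu'.2⟩
    have := (abs_le.1 ((hnumall u hu').trans (min_le_right _ _))).1
    linarith
  have hbdry : ∀ u ∈ Icc 0 h, |gHatSub k h n x y 1 u| + |gHat k h n x y u| ≤ κ / h := by
    intro u hu
    have hi : ∀ i, |gHatSub k h n x y i u| ≤ B / h * (κ / (3 * B)) := fun i =>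
      (hK.abs_gHatSub_le hkern hh n x y i hu.1 (r := 2 * h) (by linarith [hu.2])).trans
        (by gcongr)
    have e : B / h * (κ / (3 * B)) = κ / h / 3 := by field_simp
    rw [e] at hi
    have h2 : |gHat k h n x y u| ≤ |gHatSub k h n x y 0 u| + |gHatSub k h n x y 1 u| :=
      abs_add_le _ _
    linarith [hi 0, hi 1]
  have hκle : κ ≤ D / 2 / C ^ 2 * c₂ * (m - h) ^ 2 / 2 := by
    rw [hκ]
    gcongr
    linarith
  have hmain : ∀ t, t ∈ Icc m M₀ ∨ M₀ + h < t → 0 < gHat k h n x y t →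
      naive k h n x y t = msle k h n x y t := fun t ht hbt =>
    (hK.msle_eq_naive_of_bounds hh hhm hmM n x y hc₂pos (half_pos hD).le hb hnum hnum'
      (fun u hu => hK.gHatSub_zero_eq_zero hh hM₀.le n k6 hu) hbdry hκle ht hbt).symm
  refine ⟨fun t ht => ?_, fun t ht hne => ?_⟩
  · have hpos : 0 < gHat k h n x y t :=
      hc₂pos.trans_le (hb t ⟨hhm.trans_le ht.1, by linarith [ht.2]⟩).1
    exact ⟨hpos.ne', hmain t (Or.inl ht) hpos⟩
  · exact hmain t (Or.inr ht) (lt_of_le_of_ne (hgH t (by linarith)) hne.symm)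

end CurrentStatus

end

theorem corollary3p4 {Ω : Type*} [MeasurableSpace Ω] (P : Measure Ω) [IsProbabilityMeasure P]
    (X T : ℕ → Ω → ℝ) (PX PT : Measure ℝ) (f₀ g k : ℝ → ℝ) (M₀ c α : ℝ)
    (hModel : CurrentStatus.Model P X T PX PT)
    (hF : CurrentStatus.ConditionF1 PX f₀ M₀)
    (hG : CurrentStatus.ConditionG1 PT g M₀)
    (hK : CurrentStatus.ConditionK1 k)
    (hc : 0 < c) (hα : α ∈ Ioo (0 : ℝ) (1 / 3)) :
    -- Equality on `[m, M]` with probability tending to one. The second limit makes the claim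
    -- independent of the measurability of the event (`P` of a set is its outer measure).
    (∀ m M : ℝ, 0 < m → m < M → M < M₀ →
      Tendsto (fun n : ℕ => P {ω | ∀ t ∈ Icc m M, CurrentStatus.gHatRV k c α X T n t ω ≠ 0 ∧
          CurrentStatus.naiveRV k c α X T n t ω = CurrentStatus.msleRV k c α X T n t ω})
        atTop (𝓝 1) ∧
      Tendsto (fun n : ℕ => P {ω | ∀ t ∈ Icc m M, CurrentStatus.gHatRV k c α X T n t ω ≠ 0 ∧
          CurrentStatus.naiveRV k c α X T n t ω = CurrentStatus.msleRV k c α X T n t ω}ᶜ)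
        atTop (𝓝 0)) ∧
    -- Same pointwise asymptotic distribution, for every centering and scaling. For `t > M₀`, the
    -- naive estimator has to be well defined with probability tending to one.
    (∀ t : ℝ, 0 < t →
      (M₀ < t →
        Tendsto (fun n : ℕ => P {ω | CurrentStatus.gHatRV k c α X T n t ω = 0}) atTop (𝓝 0)) →
      ∀ (a b : ℕ → ℝ) (L : Measure ℝ) [IsProbabilityMeasure L],
        CurrentStatus.ConvergesInLaw P
            (fun n ω => a n * (CurrentStatus.msleRV k c α X T n t ω - b n)) L ↔
          CurrentStatus.ConvergesInLaw P
            (fun n ω => a n * (CurrentStatus.naiveRV k c α X T n t ω - b n)) L) := by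
  refine ⟨fun m M hm hmM hM => ?_, fun t ht hdef a b L _ => ?_⟩
  · have h : CurrentStatus.WHP P fun n ω => ∀ t ∈ Icc m M,
        CurrentStatus.gHatRV k c α X T n t ω ≠ 0 ∧
          CurrentStatus.naiveRV k c α X T n t ω = CurrentStatus.msleRV k c α X T n t ω :=
      (CurrentStatus.whp_msle_eq_naive hModel hF hG hK hc hα hm (hmM.trans hM).le).mono
        (Eventually.of_forall fun n ω hω t ht => hω.1 t ⟨ht.1, ht.2.trans hM.le⟩)
    exact ⟨h.tendsto_one, h⟩
  · have h : CurrentStatus.WHP P fun n ω =>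
        CurrentStatus.msleRV k c α X T n t ω = CurrentStatus.naiveRV k c α X T n t ω := by
      obtain ⟨hPX, -⟩ := hModel.isProbabilityMeasure
      rcases le_or_gt t M₀ with htM | htM
      · exact (CurrentStatus.whp_msle_eq_naive hModel hF hG hK hc hα ht htM).mono
          (Eventually.of_forall fun n ω hω => (hω.1 t ⟨le_rfl, htM⟩).2.symm)
      · have hne : CurrentStatus.WHP P fun n ω => CurrentStatus.gHatRV k c α X T n t ω ≠ 0 := by
          simpa [CurrentStatus.WHP] using hdef htM
        refine ((CurrentStatus.whp_msle_eq_naive hModel hF hG hK hc hα hF.pos le_rfl).and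
          hne).mono ?_
        filter_upwards [(CurrentStatus.tendsto_bandwidth (c := c) hα.1).eventually_lt_const
          (sub_pos.2 htM)] with n hn ω hω
        exact (hω.1.2 t (by linarith) hω.2).symm
    have h' : CurrentStatus.WHP P fun n ω => a n * (CurrentStatus.msleRV k c α X T n t ω - b n) =
        a n * (CurrentStatus.naiveRV k c α X T n t ω - b n) :=
      h.mono (Eventually.of_forall fun n ω hω => by rw [hω])
    exact ⟨fun hY => h'.convergesInLaw hY,
      fun hY => (h'.mono (Eventually.of_forall fun n ω => Eq.symm)).convergesInLaw hY⟩
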